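/- All manifolds are smooth, finite-dimensional, Hausdorff and without boundary. A Poisson–Nijenhuis structure on a manifold $M$ is a pair $(\Pi, N)$ of a smooth bivector field $\Pi$ with $[\Pi,\Pi]=0$ (Schouten bracket) and a smooth $(1,1)$-tensor $N$ with vanishing Nijenhuis torsion $\tau N(X,Y)=[NX,NY]-N[NX,Y]-N[X,NY]+N^2[X,Y]$, such that $N\circ\Pi^\sharp=\Pi^\sharp\circ N^*$ and $C(\Pi,N)(\alpha,\beta)=[\alpha,\beta]_{N\Pi}-\big([N^*\alpha,\beta]_\Pi+[\alpha,N^*\beta]_\Pi-N^*[\alpha,\beta]_\Pi\big)=0$ for all one-forms $\alpha,\beta$, where $\Pi^\sharp\alpha=\Pi(\alpha,\cdot)$ and $[\alpha,\beta]_\Pi=\mathcal L_{\Pi^\sharp\alpha}\beta-\mathcal L_{\Pi^\sharp\beta}\alpha-d(\Pi(\alpha,\beta))$. A Lie group $G$ with Lie algebra $\mathfrak g=T_1G$ and a Poisson–Nijenhuis structure $(\Pi_G,N_G)$ is right-invariant if there are $\Lambda_G\in\wedge^2\mathfrak g$ and a linear map $n_G:\mathfrak g\to\mathfrak g$ with $\Pi_G=\overrightarrow{\Lambda_G}$,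 $N_G=\overrightarrow{n_G}$, where $\overrightarrow{\Lambda_G}(a)=\wedge^2dR_a(\Lambda_G)$ and $\overrightarrow{n_G}(a)=dR_a\circ n_G\circ dR_{a^{-1}}$. Let $\Gamma\rightrightarrows B$ be a Lie groupoid with source $\alpha$ and target $\beta$, where $gh$ is defined when $\alpha(g)=\beta(h)$. Its Lie algebroid $A\Gamma$ has fibre $\ker(d\alpha)$ at the unit $1_x$, and $R_g:\alpha^{-1}(\beta(g))\to\alpha^{-1}(\alpha(g))$, $h\mapsto hg$. For $\Lambda\in\Gamma(\wedge^2A\Gamma)$ put $\overrightarrow{\Lambda}(g)=\wedge^2dR_g(\Lambda(\beta(g)))$; for a smooth bundle endomorphism $n$ of $A\Gamma$ put $\overrightarrow{n}(v)=dR_g\big(n(dR_{g^{-1}}v)\big)$ for $v\in\ker(d\alpha)_g$. A Poisson–Nijenhuis structure $(\Pi,N)$ on the manifold $\Gamma$, together with a Nijenhuis tensor $N_B$ on $B$ satisfying $d\beta\circ N=N_B\circ d\beta$, is right-invariant if $\Pi=\overrightarrow{\Lambda}$ for some smooth section $\Lambda$ of $\wedge^2A\Gamma$ and $N=\overrightarrow{n}$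 on $\ker(d\alpha)$ for some smooth bundle endomorphism $n$ of $A\Gamma$. **Proposition.** Let $(M,\Pi_M,N_M)$ be a Poisson–Nijenhuis manifold and $(G,\Pi_G,N_G)$ a right-invariant Poisson–Nijenhuis Lie group. Let $\Upsilon=M\times G\times M\rightrightarrows M$ be the trivial Lie groupoid, with target $(x,a,y)\mapsto x$, source $(x,a,y)\mapsto y$, product $(x,a,y)(y,b,z)=(x,ab,z)$, units $(x,1,x)$ and inverses $(x,a,y)^{-1}=(y,a^{-1},x)$; its Lie algebroid is identified with $TM\oplus(M\times\mathfrak g)$ through $(X,V)\mapsto(X,V,0)$. Then $$\Pi_\Upsilon=\Pi_M\oplus\Pi_G\oplus0,\qquad N_\Upsilon=N_M\oplus N_G\oplus0$$ is a right-invariant Poisson–Nijenhuis structure on $\Upsilon$, with base tensor $N_M$. Concretely, whenever $\Pi_G=\overrightarrow{\Lambda_G}$, the section $\Lambda_M\oplus\Lambda_G$ of $\wedge^2(TM\oplus(M\times\mathfrak g))$, with $\Lambda_M=\Pi_M$, is smooth and $\Pi_\Upsilon=\overrightarrow{\Lambda_M\oplus\Lambda_G}$; and whenever $N_G=\overrightarrow{n_G}$,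 the bundle endomorphism $n_M\oplus n_G$, with $n_M=N_M$, is smooth and $N_\Upsilon=\overrightarrow{n_M\oplus n_G}$ on $\ker(d\alpha)$. -/

import Mathlib

open scoped Manifold ContDiff

noncomputable section

/-! ### Bivectors on a vector space -/

/-- A bivector on a finite-dimensional real vector space `V`, i.e. an element of `∧² V`, given by
its (skew-symmetric) sharp map `P♯ : V* → V`, `P♯ α = P(α, ·)`. -/
structure Bivector (V : Type*) [AddCommGroup V] [Module ℝ V] [TopologicalSpace V] where
  sharp : (V →L[ℝ] ℝ) →ₗ[ℝ] V
  alt : ∀ α : V →L[ℝ] ℝ, α (sharp α) = 0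

namespace Bivector

variable {V W : Type*} [AddCommGroup V] [Module ℝ V] [TopologicalSpace V]
  [AddCommGroup W] [Module ℝ W] [TopologicalSpace W]

/-- The value `P(α, β)` of a bivector on two covectors. -/
def eval (P : Bivector V) (α β : V →L[ℝ] ℝ) : ℝ := β (P.sharp α)

/-- The zero bivector. -/
def zero : Bivector V where
  sharp := 0
  alt α := by simp

/-- The push-forward `∧² f : ∧² V → ∧² W` along a linear map `f`. -/
def map (f : V →L[ℝ] W) (P : Bivector V) : Bivector W where
  sharp :=
    { toFun := fun α => f (P.sharp (α.comp f))
      map_add' := fun α β => by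
        rw [ContinuousLinearMap.add_comp, map_add, map_add]
      map_smul' := fun c α => by
        rw [ContinuousLinearMap.smul_comp, map_smul, map_smul, RingHom.id_apply] }
  alt α := P.alt (α.comp f)

/-- The direct sum `P ⊕ Q ∈ ∧² V ⊕ ∧² W ⊆ ∧² (V × W)`. -/
def prod (P : Bivector V) (Q : Bivector W) : Bivector (V × W) where
  sharp :=
    { toFun := fun α =>
        (P.sharp (α.comp (ContinuousLinearMap.inl ℝ V W)),
          Q.sharp (α.comp (ContinuousLinearMap.inr ℝ V W)))
      map_add' := fun α β => by
        simp [ContinuousLinearMap.add_comp]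
      map_smul' := fun c α => by
        simp [ContinuousLinearMap.smul_comp] }
  alt α := by
    have h1 := P.alt (α.comp (ContinuousLinearMap.inl ℝ V W))
    have h2 := Q.alt (α.comp (ContinuousLinearMap.inr ℝ V W))
    simp only [LinearMap.coe_mk, AddHom.coe_mk]
    rw [← Prod.fst_add_snd (P.sharp (α.comp (ContinuousLinearMap.inl ℝ V W)),
      Q.sharp (α.comp (ContinuousLinearMap.inr ℝ V W))), map_add]
    simpa using congrArg₂ (· + ·) h1 h2

end Bivector

/-! ### Tensor fields and Poisson–Nijenhuis structures on a manifold

Manifolds are smooth, finite-dimensional, Hausdorff and without boundary wherever these notions are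
applied, so that a tensor field is determined by, and its smoothness can be tested on, globally
defined smooth functions, vector fields and one-forms. -/

section Manifold

variable {E : Type*} [NormedAddCommGroup E] [NormedSpace ℝ E] {H : Type*} [TopologicalSpace H]
  (I : ModelWithCorners ℝ E H) {M : Type*} [TopologicalSpace M] [ChartedSpace H M]
  [IsManifold I ∞ M]

/-- The differential `df` at `x`, as a covector. -/
def dif (f : M → ℝ) (x : M) : TangentSpace I x →L[ℝ] ℝ := mfderiv I 𝓘(ℝ, ℝ) f x

/-- `f ∈ C^∞(M)`. -/
def SmoothFun (f : M → ℝ) : Prop := ContMDiff I 𝓘(ℝ, ℝ) ∞ f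

/-- `X` is a smooth vector field. -/
def SmoothVF (X : ∀ x : M, TangentSpace I x) : Prop :=
  ContMDiff I I.tangent ∞ (fun x => (⟨x, X x⟩ : TangentBundle I M))

/-- `α` is a smooth one-form: it is smooth as a fibrewise linear function on `TM`. -/
def SmoothForm (α : ∀ x : M, TangentSpace I x →L[ℝ] ℝ) : Prop :=
  ContMDiff I.tangent 𝓘(ℝ, ℝ) ∞ (fun v : TangentBundle I M => α v.1 v.2)

/-- `N` is a smooth `(1,1)`-tensor: it is smooth as a bundle map `TM → TM`. -/
def SmoothEndo (N : ∀ x : M, TangentSpace I x →L[ℝ] TangentSpace I x) : Prop :=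
  ContMDiff I.tangent I.tangent ∞
    (fun v : TangentBundle I M => (⟨v.1, N v.1 v.2⟩ : TangentBundle I M))

/-- The function `{f, h}_P = P(df, dh)`. -/
def bivectorBracket (P : ∀ x : M, Bivector (TangentSpace I x)) (f h : M → ℝ) : M → ℝ :=
  fun x => (P x).eval (dif I f x) (dif I h x)

/-- `P` is a smooth bivector field. -/
def SmoothBivector (P : ∀ x : M, Bivector (TangentSpace I x)) : Prop :=
  ∀ f h : M → ℝ, SmoothFun I f → SmoothFun I h → SmoothFun I (bivectorBracket I P f h)

/-- The Schouten bracket `[P, Q]` of two bivector fields, a trivector field, evaluated on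
`df`, `dg`, `dh`. -/
def schoutenBracket (P Q : ∀ x : M, Bivector (TangentSpace I x)) (f g h : M → ℝ) : M → ℝ :=
  let p := bivectorBracket I P
  let q := bivectorBracket I Q
  fun x =>
    (p (q f g) h x + p (q g h) f x + p (q h f) g x) +
      (q (p f g) h x + q (p g h) f x + q (p h f) g x)

/-- `P` is a Poisson structure: a smooth bivector field with `[P, P] = 0`. -/
def IsPoisson (P : ∀ x : M, Bivector (TangentSpace I x)) : Prop :=
  SmoothBivector I P ∧
    ∀ f g h : M → ℝ, SmoothFun I f → SmoothFun I g → SmoothFun I h →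
      ∀ x, schoutenBracket I P P f g h x = 0

/-- The Nijenhuis torsion
`τN(X, Y) = [NX, NY] - N[NX, Y] - N[X, NY] + N²[X, Y]`. -/
def nijenhuisTorsion (N : ∀ x : M, TangentSpace I x →L[ℝ] TangentSpace I x)
    (X Y : ∀ x : M, TangentSpace I x) (x : M) : TangentSpace I x :=
  VectorField.mlieBracket I (fun y => N y (X y)) (fun y => N y (Y y)) x
    - N x (VectorField.mlieBracket I (fun y => N y (X y)) Y x)
    - N x (VectorField.mlieBracket I X (fun y => N y (Y y)) x)
    + N x (N x (VectorField.mlieBracket I X Y x))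

/-- `N` is a Nijenhuis tensor: a smooth `(1,1)`-tensor with vanishing torsion. -/
def IsNijenhuis (N : ∀ x : M, TangentSpace I x →L[ℝ] TangentSpace I x) : Prop :=
  SmoothEndo I N ∧
    ∀ X Y : (∀ x : M, TangentSpace I x), SmoothVF I X → SmoothVF I Y →
      ∀ x, nijenhuisTorsion I N X Y x = 0

/-- The Lie derivative of a one-form, evaluated on a vector field:
`(L_X β)(Y) = X(β(Y)) - β([X, Y])`. -/
def lieDerivForm (X : ∀ x : M, TangentSpace I x) (β : ∀ x : M, TangentSpace I x →L[ℝ] ℝ)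
    (Y : ∀ x : M, TangentSpace I x) (x : M) : ℝ :=
  dif I (fun y => β y (Y y)) x (X x) - β x (VectorField.mlieBracket I X Y x)

/-- The bracket of one-forms, evaluated on a vector field `Y`:
`[α, β]_P = L_{P♯α} β - L_{P♯β} α - d(P(α, β))`.
It takes the sharp map of `P` as its argument. -/
def formBracket (P : ∀ x : M, (TangentSpace I x →L[ℝ] ℝ) → TangentSpace I x)
    (α β : ∀ x : M, TangentSpace I x →L[ℝ] ℝ) (Y : ∀ x : M, TangentSpace I x) (x : M) : ℝ :=
  lieDerivForm I (fun y => P y (α y)) β Y x - lieDerivForm I (fun y => P y (β y)) α Y x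
    - dif I (fun y => β y (P y (α y))) x (Y x)

/-- The Magri–Morosi concomitant, evaluated on a vector field `Y`:
`C(P, N)(α, β) = [α, β]_{NP} - ([N*α, β]_P + [α, N*β]_P - N*[α, β]_P)`. -/
def concomitant (P : ∀ x : M, Bivector (TangentSpace I x))
    (N : ∀ x : M, TangentSpace I x →L[ℝ] TangentSpace I x)
    (α β : ∀ x : M, TangentSpace I x →L[ℝ] ℝ) (Y : ∀ x : M, TangentSpace I x) (x : M) : ℝ :=
  formBracket I (fun y ξ => N y ((P y).sharp ξ)) α β Y x
    - (formBracket I (fun y => (P y).sharp) (fun y => (α y).comp (N y)) β Y x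
      + formBracket I (fun y => (P y).sharp) α (fun y => (β y).comp (N y)) Y x
      - formBracket I (fun y => (P y).sharp) α β (fun y => N y (Y y)) x)

/-- `(P, N)` is a Poisson–Nijenhuis structure on `M`. -/
structure IsPoissonNijenhuis (P : ∀ x : M, Bivector (TangentSpace I x))
    (N : ∀ x : M, TangentSpace I x →L[ℝ] TangentSpace I x) : Prop where
  poisson : IsPoisson I P
  nijenhuis : IsNijenhuis I N
  /-- `N ∘ P♯ = P♯ ∘ N*` -/
  comm : ∀ (x : M) (ξ : TangentSpace I x →L[ℝ] ℝ),
    N x ((P x).sharp ξ) = (P x).sharp (ξ.comp (N x))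
  concomitant_eq_zero : ∀ α β : (∀ x : M, TangentSpace I x →L[ℝ] ℝ),
    SmoothForm I α → SmoothForm I β → ∀ Y : (∀ x : M, TangentSpace I x), SmoothVF I Y →
      ∀ x, concomitant I P N α β Y x = 0

end Manifold

/-! ### Right-invariant Poisson–Nijenhuis Lie groups -/

section LieGrp

variable {F : Type*} [NormedAddCommGroup F] [NormedSpace ℝ F] {K : Type*} [TopologicalSpace K]
  (J : ModelWithCorners ℝ F K) {G : Type*} [TopologicalSpace G] [ChartedSpace K G] [Group G]
  [LieGroup J ∞ G]

/-- `dR_a : 𝔤 = T_1 G → T_a G`. -/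
def groupRight (a : G) : GroupLieAlgebra J G →L[ℝ] TangentSpace J a :=
  mfderiv J J (fun b : G => b * a) 1

/-- `dR_{a⁻¹} : T_a G → T_1 G = 𝔤`. -/
def groupRightInv (a : G) : TangentSpace J a →L[ℝ] GroupLieAlgebra J G :=
  mfderiv J J (fun b : G => b * a⁻¹) a

/-- The right-invariant bivector field on `G` with value `Λ` at the identity. -/
def groupBivector (Λ : Bivector (GroupLieAlgebra J G)) (a : G) : Bivector (TangentSpace J a) :=
  Λ.map (groupRight J a)

/-- The right-invariant `(1,1)`-tensor on `G` with value `n` at the identity. -/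
def groupEndo (n : GroupLieAlgebra J G →L[ℝ] GroupLieAlgebra J G) (a : G) :
    TangentSpace J a →L[ℝ] TangentSpace J a :=
  (groupRight J a).comp (n.comp (groupRightInv J a))

/-- `(G, P, N)` is a right-invariant Poisson–Nijenhuis Lie group. -/
structure IsRightInvariantPNGroup (P : ∀ a : G, Bivector (TangentSpace J a))
    (N : ∀ a : G, TangentSpace J a →L[ℝ] TangentSpace J a) : Prop where
  pn : IsPoissonNijenhuis J P N
  bivector : ∃ Λ : Bivector (GroupLieAlgebra J G), P = groupBivector J Λ
  endo : ∃ n : GroupLieAlgebra J G →L[ℝ] GroupLieAlgebra J G, N = groupEndo J n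

end LieGrp

/-! ### Lie groupoids and right-invariant Poisson–Nijenhuis structures on them -/

section Groupoid

variable {E : Type*} [NormedAddCommGroup E] [NormedSpace ℝ E] {H : Type*} [TopologicalSpace H]
  {F : Type*} [NormedAddCommGroup F] [NormedSpace ℝ F] {K : Type*} [TopologicalSpace K]

/-- A Lie groupoid `Γ ⇉ B`, with source `src`, target `tgt`, units and inverses. The product
`mul g h` is meaningful when `src g = tgt h`; its other values are irrelevant. As the set of
composable pairs is an embedded submanifold of `Γ × Γ`, smoothness of the product on this
submanifold is `ContMDiffOn`. -/
structure LieGroupoid (I : ModelWithCorners ℝ E H) (Γ : Type*) [TopologicalSpace Γ]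
    [ChartedSpace H Γ] [IsManifold I ∞ Γ] (J : ModelWithCorners ℝ F K) (B : Type*) [TopologicalSpace B]
    [ChartedSpace K B] [IsManifold J ∞ B] where
  src : Γ → B
  tgt : Γ → B
  unit : B → Γ
  inv : Γ → Γ
  mul : Γ → Γ → Γ
  src_mul : ∀ g h, src g = tgt h → src (mul g h) = src h
  tgt_mul : ∀ g h, src g = tgt h → tgt (mul g h) = tgt g
  mul_assoc : ∀ g h k, src g = tgt h → src h = tgt k → mul (mul g h) k = mul g (mul h k)
  src_unit : ∀ x, src (unit x) = x
  tgt_unit : ∀ x, tgt (unit x) = x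
  mul_unit : ∀ g, mul g (unit (src g)) = g
  unit_mul : ∀ g, mul (unit (tgt g)) g = g
  src_inv : ∀ g, src (inv g) = tgt g
  tgt_inv : ∀ g, tgt (inv g) = src g
  mul_inv : ∀ g, mul g (inv g) = unit (tgt g)
  inv_mul : ∀ g, mul (inv g) g = unit (src g)
  smooth_src : ContMDiff I J ∞ src
  smooth_tgt : ContMDiff I J ∞ tgt
  smooth_unit : ContMDiff J I ∞ unit
  smooth_inv : ContMDiff I I ∞ inv
  smooth_mul : ContMDiffOn (I.prod I) I ∞ (fun p : Γ × Γ => mul p.1 p.2)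
    {p | src p.1 = tgt p.2}
  submersion_src : ∀ g, Function.Surjective (mfderiv I J src g)
  submersion_tgt : ∀ g, Function.Surjective (mfderiv I J tgt g)

namespace LieGroupoid

variable {I : ModelWithCorners ℝ E H} {Γ : Type*} [TopologicalSpace Γ]
  [ChartedSpace H Γ] [IsManifold I ∞ Γ] {J : ModelWithCorners ℝ F K} {B : Type*} [TopologicalSpace B]
  [ChartedSpace K B] [IsManifold J ∞ B] (S : LieGroupoid I Γ J B)

/-- The space `ker (d src)_g` of vectors at `g` tangent to the source fibre. -/
def vertical (g : Γ) : Submodule ℝ (TangentSpace I g) :=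
  LinearMap.ker (mfderiv I J S.src g).toLinearMap

/-- The fibre at `x` of the Lie algebroid: the vertical space at the unit of `x`. -/
abbrev algebroid (x : B) : Submodule ℝ (TangentSpace I (S.unit x)) := S.vertical (S.unit x)

/-- The right translation `R_g : h ↦ h g`, defined on the source fibre over `tgt g`. -/
def rightTrans (g : Γ) : Γ → Γ := fun h => S.mul h g

/-- The source fibre on which `R_g` is defined. -/
def rightDomain (g : Γ) : Set Γ := {h | S.src h = S.tgt g}

/-- The derivative of `R_g : src⁻¹(tgt g) → Γ` at the unit over `tgt g`. Only its values on
vertical vectors matter; there, the derivative within the source fibre is unambiguous. -/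
def dRight (g : Γ) : TangentSpace I (S.unit (S.tgt g)) →L[ℝ] TangentSpace I g :=
  mfderivWithin I I (S.rightTrans g) (S.rightDomain g) (S.unit (S.tgt g))

/-- The derivative of `R_{g⁻¹} : src⁻¹(src g) → Γ` at `g`; it takes values at
`g g⁻¹ = unit (tgt g)`. Again only its values on vertical vectors matter. -/
def dRightInv (g : Γ) : TangentSpace I g →L[ℝ] TangentSpace I (S.unit (S.tgt g)) :=
  mfderivWithin I I (S.rightTrans (S.inv g)) (S.rightDomain (S.inv g)) g

/-- The bivector field `Λ→(g) = ∧² dR_g (Λ(tgt g))` on `Γ`. -/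
def rightBivector (Λ : ∀ x, Bivector (S.algebroid x)) (g : Γ) : Bivector (TangentSpace I g) :=
  (Λ (S.tgt g)).map ((S.dRight g).comp (S.algebroid (S.tgt g)).subtypeL)

/-- `a` is a smooth section of the Lie algebroid. -/
def SmoothSection (a : ∀ x, S.algebroid x) : Prop :=
  ContMDiff J I.tangent ∞ (fun x => (⟨S.unit x, (a x : TangentSpace I (S.unit x))⟩ :
    TangentBundle I Γ))

/-- `Λ` is a smooth section of the second exterior power of the Lie algebroid. -/
def SmoothBivectorSection (Λ : ∀ x, Bivector (S.algebroid x)) : Prop :=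
  ∀ f h : Γ → ℝ, SmoothFun I f → SmoothFun I h →
    SmoothFun J (fun x => (Λ x).eval
      ((dif I f (S.unit x)).comp (S.algebroid x).subtypeL)
      ((dif I h (S.unit x)).comp (S.algebroid x).subtypeL))

/-- `n` is a smooth bundle endomorphism of the Lie algebroid, i.e. it acts on smooth sections. -/
def SmoothEndoSection (n : ∀ x, S.algebroid x →L[ℝ] S.algebroid x) : Prop :=
  ∀ a : (∀ x, S.algebroid x), S.SmoothSection a → S.SmoothSection (fun x => n x (a x))

/-- `N = n→`, that is, for all `g` and all vertical `v` at `g`, the vector `dR_{g⁻¹} v` lies in the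
Lie algebroid and `N v = dR_g (n (dR_{g⁻¹} v))`. -/
def IsRightEndo (n : ∀ x, S.algebroid x →L[ℝ] S.algebroid x)
    (N : ∀ g : Γ, TangentSpace I g →L[ℝ] TangentSpace I g) : Prop :=
  ∀ g : Γ, ∀ v ∈ S.vertical g, ∃ a : S.algebroid (S.tgt g),
    (a : TangentSpace I (S.unit (S.tgt g))) = S.dRightInv g v ∧
      N g v = S.dRight g (n (S.tgt g) a)

/-- `(P, (N, NB))` is a right-invariant Poisson–Nijenhuis structure on the Lie groupoid, where
`NB` is the Nijenhuis tensor induced by `N` on the base (along the target map). -/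
structure IsRightInvariantPN (P : ∀ g : Γ, Bivector (TangentSpace I g))
    (N : ∀ g : Γ, TangentSpace I g →L[ℝ] TangentSpace I g)
    (NB : ∀ x : B, TangentSpace J x →L[ℝ] TangentSpace J x) : Prop where
  pn : IsPoissonNijenhuis I P N
  bivector : ∃ Λ : (∀ x, Bivector (S.algebroid x)),
    S.SmoothBivectorSection Λ ∧ P = S.rightBivector Λ
  endo : ∃ n : (∀ x, S.algebroid x →L[ℝ] S.algebroid x),
    S.SmoothEndoSection n ∧ S.IsRightEndo n N
  base_nijenhuis : IsNijenhuis J NB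
  base_related : ∀ (g : Γ) (v : TangentSpace I g),
    mfderiv I J S.tgt g (N g v) = NB (S.tgt g) (mfderiv I J S.tgt g v)

end LieGroupoid

end Groupoid

/-! ### The trivial Lie groupoid `M × G × M ⇉ M` -/

section Trivial

variable {E : Type*} [NormedAddCommGroup E] [NormedSpace ℝ E] {H : Type*} [TopologicalSpace H]
  (I : ModelWithCorners ℝ E H) {M : Type*} [TopologicalSpace M] [ChartedSpace H M]
  {F : Type*} [NormedAddCommGroup F] [NormedSpace ℝ F] {K : Type*} [TopologicalSpace K]
  (J : ModelWithCorners ℝ F K) {G : Type*} [TopologicalSpace G] [ChartedSpace K G]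

/-- The canonical identification `T_x M × T_a G × T_y M = T_{(x, a, y)} (M × G × M)`. -/
def tangentTriple (p : M × G × M) :
    (TangentSpace I p.1 × TangentSpace J p.2.1 × TangentSpace I p.2.2) ≃L[ℝ]
      TangentSpace (I.prod (J.prod I)) p :=
  ContinuousLinearEquiv.refl ℝ (E × F × E)

/-- The bivector field `P_M ⊕ P_G ⊕ 0` on `M × G × M`. -/
def tripleBivector (PM : ∀ x : M, Bivector (TangentSpace I x))
    (PG : ∀ a : G, Bivector (TangentSpace J a)) (p : M × G × M) :
    Bivector (TangentSpace (I.prod (J.prod I)) p) :=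
  ((PM p.1).prod ((PG p.2.1).prod Bivector.zero)).map (tangentTriple I J p).toContinuousLinearMap

/-- The `(1,1)`-tensor `N_M ⊕ N_G ⊕ 0` on `M × G × M`. -/
def tripleEndo (NM : ∀ x : M, TangentSpace I x →L[ℝ] TangentSpace I x)
    (NG : ∀ a : G, TangentSpace J a →L[ℝ] TangentSpace J a) (p : M × G × M) :
    TangentSpace (I.prod (J.prod I)) p →L[ℝ] TangentSpace (I.prod (J.prod I)) p :=
  (tangentTriple I J p).toContinuousLinearMap.comp
    (((NM p.1).prodMap ((NG p.2.1).prodMap 0)).comp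
      (tangentTriple I J p).symm.toContinuousLinearMap)

variable (M G) [IsManifold I ∞ M] [Group G] [LieGroup J ∞ G]

/-- The trivial Lie groupoid `M × G × M ⇉ M`: the arrow `(x, a, y)` has target `x` and source `y`,
and `(x, a, y) (y, b, z) = (x, a b, z)`. -/
def trivialGroupoid : LieGroupoid (I.prod (J.prod I)) (M × G × M) I M where
  src p := p.2.2
  tgt p := p.1
  unit x := (x, 1, x)
  inv p := (p.2.2, p.2.1⁻¹, p.1)
  mul p q := (p.1, p.2.1 * q.2.1, q.2.2)
  src_mul _ _ _ := rfl
  tgt_mul _ _ _ := rfl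
  mul_assoc _ _ _ _ _ := by simp [mul_assoc]
  src_unit _ := rfl
  tgt_unit _ := rfl
  mul_unit _ := by simp
  unit_mul _ := by simp
  src_inv _ := rfl
  tgt_inv _ := rfl
  mul_inv _ := by simp
  inv_mul _ := by simp
  smooth_src := contMDiff_snd.comp contMDiff_snd
  smooth_tgt := contMDiff_fst
  smooth_unit := contMDiff_id.prodMk (contMDiff_const.prodMk contMDiff_id)
  smooth_inv := (contMDiff_snd.comp contMDiff_snd).prodMk
    (((contMDiff_fst.comp contMDiff_snd).inv).prodMk contMDiff_fst)
  smooth_mul := ((contMDiff_fst.comp contMDiff_fst).prodMk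
    (((contMDiff_fst.comp (contMDiff_snd.comp contMDiff_fst)).mul
      (contMDiff_fst.comp (contMDiff_snd.comp contMDiff_snd))).prodMk
      (contMDiff_snd.comp (contMDiff_snd.comp contMDiff_snd)))).contMDiffOn
  submersion_src p v := by
    have h : HasMFDerivAt (I.prod (J.prod I)) I (fun q : M × G × M => q.2.2) p
        ((ContinuousLinearMap.snd ℝ (TangentSpace J p.2.1) (TangentSpace I p.2.2)).comp
          (ContinuousLinearMap.snd ℝ (TangentSpace I p.1) (TangentSpace (J.prod I) p.2))) :=
      (hasMFDerivAt_snd p.2).comp p (hasMFDerivAt_snd p)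
    rw [h.mfderiv]
    exact ⟨tangentTriple I J p (0, 0, v), rfl⟩
  submersion_tgt p v := by
    rw [mfderiv_fst]
    exact ⟨tangentTriple I J p (v, 0, 0), rfl⟩

variable {M G}

/-- The vertical space of the trivial groupoid at `p` consists of the vectors `(X, V, 0)`. -/
theorem mem_vertical_trivialGroupoid (p : M × G × M)
    (w : TangentSpace I p.1 × TangentSpace J p.2.1 × TangentSpace I p.2.2) :
    tangentTriple I J p w ∈ (trivialGroupoid I M J G).vertical p ↔ w.2.2 = 0 := by
  have h : HasMFDerivAt (I.prod (J.prod I)) I (trivialGroupoid I M J G).src p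
      ((ContinuousLinearMap.snd ℝ (TangentSpace J p.2.1) (TangentSpace I p.2.2)).comp
        (ContinuousLinearMap.snd ℝ (TangentSpace I p.1) (TangentSpace (J.prod I) p.2))) :=
    (hasMFDerivAt_snd p.2).comp p (hasMFDerivAt_snd p)
  rw [LieGroupoid.vertical, h.mfderiv]
  rfl

/-- The canonical identification of the Lie algebroid of the trivial groupoid with
`TM ⊕ (M × 𝔤)`; on fibres, `(X, V) ↦ (X, V, 0)`. -/
def trivialAlgebroid (x : M) :
    (TangentSpace I x × GroupLieAlgebra J G) ≃L[ℝ] (trivialGroupoid I M J G).algebroid x where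
  toFun w := ⟨tangentTriple I J (x, 1, x) (w.1, w.2, 0),
    (mem_vertical_trivialGroupoid I J (x, 1, x) (w.1, w.2, 0)).2 rfl⟩
  invFun a := (((tangentTriple I J (x, 1, x)).symm a.1).1,
    ((tangentTriple I J (x, 1, x)).symm a.1).2.1)
  left_inv w := rfl
  right_inv a := by
    have h := (mem_vertical_trivialGroupoid I J (x, 1, x)
      ((tangentTriple I J (x, 1, x)).symm a.1)).1 a.2
    apply Subtype.ext
    apply (tangentTriple I J (x, 1, x)).symm.injective
    exact Prod.ext rfl (Prod.ext rfl h.symm)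
  map_add' v w := by
    apply Subtype.ext
    apply (tangentTriple I J (x, 1, x)).symm.injective
    exact Prod.ext rfl (Prod.ext rfl (add_zero (0 : TangentSpace I x)).symm)
  map_smul' c w := by
    apply Subtype.ext
    apply (tangentTriple I J (x, 1, x)).symm.injective
    exact Prod.ext rfl (Prod.ext rfl (smul_zero c : c • (0 : TangentSpace I x) = 0).symm)
  continuous_toFun := ((tangentTriple I J (x, (1 : G), x)).continuous.comp
    (continuous_fst.prodMk (continuous_snd.prodMk continuous_const))).subtype_mk _
  continuous_invFun := by
    have h := (tangentTriple I J (x, (1 : G), x)).symm.continuous.comp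
      (continuous_subtype_val (p := (· ∈ (trivialGroupoid I M J G).algebroid x)))
    exact (continuous_fst.comp h).prodMk (continuous_fst.comp (continuous_snd.comp h))

/-- The section `Λ_M ⊕ Λ_G` of the second exterior power of `TM ⊕ (M × 𝔤)`. -/
def trivialBivector (ΛM : ∀ x : M, Bivector (TangentSpace I x))
    (ΛG : Bivector (GroupLieAlgebra J G)) (x : M) :
    Bivector ((trivialGroupoid I M J G).algebroid x) :=
  ((ΛM x).prod ΛG).map (trivialAlgebroid I J x).toContinuousLinearMap

/-- The bundle endomorphism `n_M ⊕ n_G` of `TM ⊕ (M × 𝔤)`. -/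
def trivialEndo (nM : ∀ x : M, TangentSpace I x →L[ℝ] TangentSpace I x)
    (nG : GroupLieAlgebra J G →L[ℝ] GroupLieAlgebra J G) (x : M) :
    (trivialGroupoid I M J G).algebroid x →L[ℝ] (trivialGroupoid I M J G).algebroid x :=
  (trivialAlgebroid I J x).toContinuousLinearMap.comp
    (((nM x).prodMap nG).comp (trivialAlgebroid I J x).symm.toContinuousLinearMap)

end Trivial

end

/-!
The Schouten bracket, the Nijenhuis torsion and the concomitant are tensorial: at a point they
depend only on the differentials, vectors and covectors at that point. At `p = (x, q)`, every
function on a product `M × Q` has the same differential as the direct sum of its two slices through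
`p`, and every vector field or one-form has the same value as the direct sum of its slices. On
direct sums of functions, vector fields and one-forms all the brackets split, so the direct sum of
two Poisson–Nijenhuis structures is Poisson–Nijenhuis. Right-invariance on the trivial groupoid
holds because `dR_{(x, a, y)}` maps `(X, V, 0)` in the Lie algebroid to `(X, dR_a V, 0)`.
-/

noncomputable section

open scoped Topology Bundle
open VectorField Filter

section Basic

variable {E : Type*} [NormedAddCommGroup E] [NormedSpace ℝ E] {H : Type*} [TopologicalSpace H]
  {I : ModelWithCorners ℝ E H} {M : Type*} [TopologicalSpace M] [ChartedSpace H M]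
  {f g : M → ℝ} {X Y : ∀ x : M, TangentSpace I x} {α β : ∀ x : M, TangentSpace I x →L[ℝ] ℝ}
  {N : ∀ x : M, TangentSpace I x →L[ℝ] TangentSpace I x} {x : M}

theorem mvfderiv_eq_dif : mvfderiv I f x = dif I f x := rfl

theorem dif_add (hf : MDiffAt f x) (hg : MDiffAt g x) :
    dif I (f + g) x = dif I f x + dif I g x := by
  simp only [← mvfderiv_eq_dif, mvfderiv_add hf hg]

theorem dif_fun_neg : dif I (-f) x = -dif I f x := by
  simp only [← mvfderiv_eq_dif, mvfderiv_neg]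

theorem dif_mul (hf : MDiffAt f x) (hg : MDiffAt g x) :
    dif I (f * g) x = f x • dif I g x + g x • dif I f x := by
  simp only [← mvfderiv_eq_dif, mvfderiv_mul hf hg]

theorem dif_zero : dif I (0 : M → ℝ) x = 0 := by
  rw [← mvfderiv_eq_dif, mvfderiv_zero]

theorem dif_comp_apply {E' : Type*} [NormedAddCommGroup E'] [NormedSpace ℝ E'] {H' : Type*}
    [TopologicalSpace H'] {I' : ModelWithCorners ℝ E' H'} {M' : Type*} [TopologicalSpace M']
    [ChartedSpace H' M'] {φ : M → M'} {k : M' → ℝ} (hk : MDiffAt k (φ x)) (hφ : MDiffAt φ x)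
    (v : TangentSpace I x) :
    dif I (k ∘ φ) x v = dif I' k (φ x) (mfderiv I I' φ x v) :=
  mfderiv_comp_apply x hk hφ v

theorem SmoothFun.mdifferentiableAt (hf : SmoothFun I f) : MDiffAt f x :=
  ContMDiff.mdifferentiableAt hf (by simp)

variable [IsManifold I ∞ M]

theorem SmoothVF.mdifferentiableAt (hX : SmoothVF I X) : MDiffAt (T% X) x :=
  ContMDiff.mdifferentiableAt hX (by simp)

theorem SmoothFun.smoothForm_dif (hf : SmoothFun I f) : SmoothForm I (dif I f) :=
  (contMDiff_snd_tangentBundle_modelSpace ℝ 𝓘(ℝ, ℝ)).comp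
    (ContMDiff.contMDiff_tangentMap hf (m := ∞) (by simp))

theorem SmoothForm.apply (hα : SmoothForm I α) (hX : SmoothVF I X) :
    SmoothFun I (fun y => α y (X y)) :=
  ContMDiff.comp (g := fun v : TangentBundle I M => α v.1 v.2) hα hX

theorem SmoothForm.mdifferentiableAt_apply (hα : SmoothForm I α) (hX : MDiffAt (T% X) x) :
    MDiffAt (fun y => α y (X y)) x :=
  MDifferentiableAt.comp (g := fun v : TangentBundle I M => α v.1 v.2) x
    (ContMDiff.mdifferentiableAt hα (by simp)) hX

theorem SmoothForm.sub (hα : SmoothForm I α) (hβ : SmoothForm I β) : SmoothForm I (α - β) :=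
  ContMDiff.sub hα hβ

theorem SmoothForm.comp (hα : SmoothForm I α) (hN : SmoothEndo I N) :
    SmoothForm I (fun y => (α y).comp (N y)) :=
  ContMDiff.comp (g := fun v : TangentBundle I M => α v.1 v.2) hα hN

theorem SmoothEndo.apply (hN : SmoothEndo I N) (hX : SmoothVF I X) :
    SmoothVF I (fun y => N y (X y)) :=
  ContMDiff.comp (g := fun v : TangentBundle I M => (⟨v.1, N v.1 v.2⟩ : TangentBundle I M)) hN hX

theorem SmoothEndo.mdifferentiableAt_apply (hN : SmoothEndo I N) (hX : MDiffAt (T% X) x) :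
    MDiffAt (T% fun y => N y (X y)) x :=
  MDifferentiableAt.comp
    (g := fun v : TangentBundle I M => (⟨v.1, N v.1 v.2⟩ : TangentBundle I M)) x
    (ContMDiff.mdifferentiableAt hN (by simp)) hX

theorem SmoothFun.dif_apply (hf : SmoothFun I f) (hX : SmoothVF I X) :
    SmoothFun I (fun y => dif I f y (X y)) :=
  hf.smoothForm_dif.apply hX

variable (I M) in
theorem isManifold_minSmoothness (n : ℕ) : IsManifold I (minSmoothness ℝ n) M := by
  rw [minSmoothness_of_isRCLikeNormedField]
  exact IsManifold.of_le (n := ∞) (mod_cast le_top)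

variable [CompleteSpace E]

theorem mlieBracket_mlieBracket_smul_right {W : ∀ x : M, TangentSpace I x}
    (hY : SmoothVF I Y) (hf : SmoothFun I f) (hW : ContMDiffAt I I.tangent ∞ (T% W) x) :
    mlieBracket I X (mlieBracket I Y (f • W)) x =
      dif I (fun y => dif I f y (Y y)) x (X x) • W x + dif I f x (Y x) • mlieBracket I X W x
        + (dif I f x (X x) • mlieBracket I Y W x
          + f x • mlieBracket I X (mlieBracket I Y W) x) := by
  have := isManifold_minSmoothness I M 3
  have hW' : ∀ᶠ y in 𝓝 x, MDiffAt (T% W) y := by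
    filter_upwards [(contMDiffAt_iff_contMDiffAt_nhds (n := 1) (by simp)).1
      (hW.of_le (mod_cast le_top))] with y hy
    exact hy.mdifferentiableAt one_ne_zero
  have : IsManifold I (2 + 1) M := IsManifold.of_le (n := ∞) (WithTop.coe_le_coe.2 le_top)
  have hYW : MDiffAt (T% (mlieBracket I Y W)) x :=
    (ContMDiffAt.mlieBracket_vectorField (m := 1) (n := 2) ((hY x).of_le (mod_cast le_top))
      (hW.of_le (mod_cast le_top)) (by simp [one_add_one_eq_two])).mdifferentiableAt one_ne_zero
  have hsmul : mlieBracket I Y (f • W) =ᶠ[𝓝 x]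
      (fun y => dif I f y (Y y)) • W + f • mlieBracket I Y W := by
    filter_upwards [hW'] with y hy
    exact mlieBracket_smul_right hf.mdifferentiableAt hy
  have hf' : MDiffAt f x := hf.mdifferentiableAt
  have hfY : MDiffAt (fun y => dif I f y (Y y)) x := (hf.dif_apply hY).mdifferentiableAt
  rw [EventuallyEq.rfl.mlieBracket_vectorField_eq hsmul,
    mlieBracket_add_right (hfY.smul_section hW'.self_of_nhds) (hf'.smul_section hYW),
    mlieBracket_smul_right hfY hW'.self_of_nhds, mlieBracket_smul_right hf' hYW]
  rfl

/- Compare the coefficients of `W x` in the two sides of the Jacobi identity for `X`, `Y` and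
`f • W`, where `W` is a vector field with `W x ≠ 0`. -/
theorem dif_mlieBracket (hX : SmoothVF I X) (hY : SmoothVF I Y) (hf : SmoothFun I f) (x : M) :
    dif I f x (mlieBracket I X Y x) =
      dif I (fun y => dif I f y (Y y)) x (X x) - dif I (fun y => dif I f y (X y)) x (Y x) := by
  have := isManifold_minSmoothness I M 3
  rcases subsingleton_or_nontrivial E with hE | hE
  · have h0 (v : TangentSpace I x) : v = 0 := Subsingleton.elim (α := E) v 0
    rw [h0 (mlieBracket I X Y x), h0 (X x), h0 (Y x)]
    simp
  obtain ⟨v, hv⟩ : ∃ v : TangentSpace I x, v ≠ 0 := exists_ne (0 : E)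
  let W : ∀ y : M, TangentSpace I y := FiberBundle.extend E (x := x) v
  have hWx : W x = v := FiberBundle.extend_apply_self E (x := x) _
  obtain ⟨s, hs, hWs⟩ := FiberBundle.exists_contMDiffOn_extend (k := ∞) (V := TangentSpace I)
    (x₀ := x) I E v
  have hW : ContMDiffAt I I.tangent ∞ (T% W) x := hWs.contMDiffAt hs
  have hjacobi {Z : ∀ x : M, TangentSpace I x} (hZ : ContMDiffAt I I.tangent ∞ (T% Z) x) :
      mlieBracket I X (mlieBracket I Y Z) x = mlieBracket I (mlieBracket I X Y) Z x
        + mlieBracket I Y (mlieBracket I X Z) x := by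
    have hle : minSmoothness ℝ 2 ≤ (∞ : WithTop ℕ∞) := by
      rw [minSmoothness_of_isRCLikeNormedField]
      exact WithTop.coe_le_coe.2 le_top
    exact leibniz_identity_mlieBracket_apply (hX.contMDiffAt.of_le hle) (hY.contMDiffAt.of_le hle)
      (hZ.of_le hle)
  have h := hjacobi (hf.contMDiffAt.smul_section hW)
  rw [mlieBracket_mlieBracket_smul_right hY hf hW,
    mlieBracket_mlieBracket_smul_right hX hf hW,
    mlieBracket_smul_right hf.mdifferentiableAt (hW.mdifferentiableAt (by simp)), hjacobi hW, hWx,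
    mvfderiv_eq_dif] at h
  have hsmul : (dif I f x (mlieBracket I X Y x) -
      (dif I (fun y => dif I f y (Y y)) x (X x) - dif I (fun y => dif I f y (X y)) x (Y x))) • v
        = 0 := by
    linear_combination (norm := module) (-1 : ℝ) • h
  exact sub_eq_zero.1 ((smul_eq_zero.1 hsmul).resolve_right hv)

end Basic

section Frame

theorem covector_eq_sum {V ι : Type*} [AddCommGroup V] [Module ℝ V] [TopologicalSpace V]
    [IsTopologicalAddGroup V] [ContinuousSMul ℝ V] [Fintype ι] {θ : ι → V →L[ℝ] ℝ} {e : ι → V}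
    (h : ∀ v, v = ∑ i, θ i v • e i) (ξ : V →L[ℝ] ℝ) : ξ = ∑ i, ξ (e i) • θ i := by
  ext v
  conv_lhs => rw [h v]
  simp [mul_comm]

theorem Bivector.eval_eq_sum_left {V ι : Type*} [AddCommGroup V] [Module ℝ V] [TopologicalSpace V]
    [IsTopologicalAddGroup V] [ContinuousSMul ℝ V] [Fintype ι] (P : Bivector V)
    {θ : ι → V →L[ℝ] ℝ} {e : ι → V} (h : ∀ v, v = ∑ i, θ i v • e i) (ξ η : V →L[ℝ] ℝ) :
    P.eval ξ η = ∑ i, ξ (e i) * P.eval (θ i) η := by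
  unfold Bivector.eval
  conv_lhs => rw [covector_eq_sum h ξ]
  simp only [map_sum, map_smul, smul_eq_mul]

theorem Bivector.eval_swap {V : Type*} [AddCommGroup V] [Module ℝ V] [TopologicalSpace V]
    [IsTopologicalAddGroup V] (P : Bivector V) (ξ η : V →L[ℝ] ℝ) :
    P.eval ξ η = -P.eval η ξ := by
  have h := P.alt (ξ + η)
  simp only [map_add, add_apply, P.alt] at h
  simp only [Bivector.eval]
  linarith

theorem Bivector.eval_eq_sum {V ι : Type*} [AddCommGroup V] [Module ℝ V] [TopologicalSpace V]
    [IsTopologicalAddGroup V] [ContinuousSMul ℝ V] [Fintype ι] (P : Bivector V)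
    {θ : ι → V →L[ℝ] ℝ} {e : ι → V} (h : ∀ v, v = ∑ i, θ i v • e i) (ξ η : V →L[ℝ] ℝ) :
    P.eval ξ η = ∑ i, ∑ j, ξ (e i) * (η (e j) * P.eval (θ i) (θ j)) := by
  rw [P.eval_eq_sum_left h]
  refine Finset.sum_congr rfl fun i _ => ?_
  rw [← Finset.mul_sum, P.eval_swap, P.eval_eq_sum_left h, ← Finset.sum_neg_distrib]
  simp only [P.eval_swap (θ i), mul_neg]

variable {E : Type*} [NormedAddCommGroup E] [NormedSpace ℝ E] {H : Type*} [TopologicalSpace H]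
  {I : ModelWithCorners ℝ E H} {M : Type*} [TopologicalSpace M] [ChartedSpace H M]
  [IsManifold I ∞ M]

theorem dif_comp_extChartAt (l : E →L[ℝ] ℝ) {x₀ x : M} (hx : x ∈ (chartAt H x₀).source)
    (v : TangentSpace I x) :
    dif I (fun y => l (extChartAt I x₀ y)) x v =
      l ((trivializationAt E (TangentSpace I) x₀).continuousLinearMapAt ℝ x v) := by
  rw [TangentBundle.continuousLinearMapAt_trivializationAt hx]
  have h := mfderiv_comp_apply (I' := 𝓘(ℝ, E)) (I'' := 𝓘(ℝ, ℝ)) x l.mdifferentiableAt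
    (mdifferentiableAt_extChartAt hx) v
  rwa [ContinuousLinearMap.mfderiv_eq] at h

variable [FiniteDimensional ℝ E] [T2Space M]

variable (I) in
theorem exists_smoothFun_eventuallyEq (x : M) (l : E →L[ℝ] ℝ) :
    ∃ φ : M → ℝ, SmoothFun I φ ∧ φ =ᶠ[𝓝 x] fun y => l (extChartAt I x y) := by
  let χ : SmoothBumpFunction I x := Classical.arbitrary _
  refine ⟨fun y => χ y • l (extChartAt I x y), χ.contMDiff_smul ?_, ?_⟩
  · exact l.contMDiff.comp_contMDiffOn (contMDiffOn_extChartAt (I := I) (n := ∞) (x := x))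
  · filter_upwards [χ.eventuallyEq_one] with y hy
    simp [hy]

variable (I) in
theorem exists_dual_frame (x₀ : M) :
    ∃ (φ : Fin (Module.finrank ℝ E) → M → ℝ)
      (e : Fin (Module.finrank ℝ E) → ∀ x : M, TangentSpace I x),
      (∀ i, SmoothFun I (φ i)) ∧ (∀ i, ContMDiffAt I I.tangent ∞ (T% (e i)) x₀) ∧
      ∀ᶠ x in 𝓝 x₀, ∀ v : TangentSpace I x, v = ∑ i, dif I (φ i) x v • e i x := by
  let b := Module.finBasis ℝ E
  choose φ hφ hφe using fun i : Fin (Module.finrank ℝ E) =>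
    exists_smoothFun_eventuallyEq I x₀ (b.coord i).toContinuousLinearMap
  let T := trivializationAt E (TangentSpace I) x₀
  have hx₀ : x₀ ∈ T.baseSet := FiberBundle.mem_baseSet_trivializationAt' x₀
  refine ⟨φ, T.localFrame b, hφ, fun i => contMDiffAt_localFrame_of_mem ∞ T b i hx₀, ?_⟩
  have hφ' : ∀ᶠ x in 𝓝 x₀, ∀ i, φ i =ᶠ[𝓝 x] fun y => b.coord i (extChartAt I x₀ y) :=
    eventually_all.2 fun i => (hφe i).eventuallyEq_nhds
  filter_upwards [hφ', T.open_baseSet.mem_nhds hx₀, (chartAt H x₀).open_source.mem_nhds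
    (mem_chart_source H x₀)] with x hx hxT hxs v
  have hcoord (i) : dif I (φ i) x v = (T.basisAt b hxT).repr v i := by
    have hT : T.continuousLinearMapAt ℝ x v = T.linearEquivAt ℝ x hxT v := by
      rw [Bundle.Trivialization.continuousLinearMapAt_apply,
        Bundle.Trivialization.coe_linearMapAt_of_mem _ hxT]
      rfl
    rw [dif, (hx i).mfderiv_eq]
    refine (dif_comp_extChartAt (b.coord i).toContinuousLinearMap hxs v).trans ?_
    rw [hT]
    rfl
  conv_lhs => rw [← (T.basisAt b hxT).sum_repr v]
  exact Finset.sum_congr rfl fun i _ => by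
    rw [hcoord, Bundle.Trivialization.localFrame_apply_of_mem_baseSet]

theorem eq_of_forall_smoothFun_dif_eq {x : M} {v w : TangentSpace I x}
    (h : ∀ f : M → ℝ, SmoothFun I f → dif I f x v = dif I f x w) : v = w := by
  obtain ⟨φ, e, hφ, -, he⟩ := exists_dual_frame I x
  rw [he.self_of_nhds v, he.self_of_nhds w]
  exact Finset.sum_congr rfl fun i _ => by rw [h _ (hφ i)]

variable {P : ∀ x : M, Bivector (TangentSpace I x)}

theorem SmoothBivector.smoothVF_sharp (hP : SmoothBivector I P)
    {α : ∀ x : M, TangentSpace I x →L[ℝ] ℝ} (hα : SmoothForm I α) :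
    SmoothVF I (fun x => (P x).sharp (α x)) := by
  intro x₀
  obtain ⟨φ, e, hφ, hes, he⟩ := exists_dual_frame I x₀
  have hc (i) : ContMDiffAt I 𝓘(ℝ, ℝ) ∞ (fun x => α x (e i x)) x₀ :=
    ContMDiffAt.comp (g := fun v : TangentBundle I M => α v.1 v.2) x₀ hα.contMDiffAt (hes i)
  have hs : ContMDiffAt I I.tangent ∞
      (T% fun x => ∑ j, (∑ i, α x (e i x) * bivectorBracket I P (φ i) (φ j) x) • e j x) x₀ := by
    refine ContMDiffAt.sum_section fun j _ => ContMDiffAt.smul_section ?_ (hes j)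
    exact contMDiffAt_finsetSum fun i _ => (hc i).mul (hP _ _ (hφ i) (hφ j)).contMDiffAt
  refine hs.congr_of_eventuallyEq ?_
  filter_upwards [he] with x hx
  congr 1
  rw [hx ((P x).sharp (α x))]
  refine Finset.sum_congr rfl fun j _ => ?_
  congr 1
  exact (P x).eval_eq_sum_left hx (α x) (dif I (φ j) x)

/- Along a map `a`, a covector field is tested on local vector fields of `M`, since it need not
come from a form on `M`. -/
theorem SmoothBivector.contMDiffAt_eval_comp (hP : SmoothBivector I P) {D : Type*}
    [NormedAddCommGroup D] [NormedSpace ℝ D] {L : Type*} [TopologicalSpace L]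
    {R : ModelWithCorners ℝ D L} {Z : Type*} [TopologicalSpace Z] [ChartedSpace L Z] {a : Z → M}
    {z₀ : Z} (ha : ContMDiffAt R I ∞ a z₀) {ξ η : ∀ z, TangentSpace I (a z) →L[ℝ] ℝ}
    (hξ : ∀ X : ∀ x : M, TangentSpace I x, ContMDiffAt I I.tangent ∞ (T% X) (a z₀) →
      ContMDiffAt R 𝓘(ℝ, ℝ) ∞ (fun z => ξ z (X (a z))) z₀)
    (hη : ∀ X : ∀ x : M, TangentSpace I x, ContMDiffAt I I.tangent ∞ (T% X) (a z₀) →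
      ContMDiffAt R 𝓘(ℝ, ℝ) ∞ (fun z => η z (X (a z))) z₀) :
    ContMDiffAt R 𝓘(ℝ, ℝ) ∞ (fun z => (P (a z)).eval (ξ z) (η z)) z₀ := by
  obtain ⟨φ, e, hφ, hes, he⟩ := exists_dual_frame I (a z₀)
  have hs : ContMDiffAt R 𝓘(ℝ, ℝ) ∞ (fun z => ∑ i, ∑ j, ξ z (e i (a z)) *
      (η z (e j (a z)) * bivectorBracket I P (φ i) (φ j) (a z))) z₀ :=
    contMDiffAt_finsetSum fun i _ => contMDiffAt_finsetSum fun j _ =>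
      (hξ _ (hes i)).mul ((hη _ (hes j)).mul ((hP _ _ (hφ i) (hφ j)).contMDiffAt.comp z₀ ha))
  refine hs.congr_of_eventuallyEq ?_
  filter_upwards [ha.continuousAt.eventually he] with z hz
  exact (P (a z)).eval_eq_sum hz (ξ z) (η z)

theorem mfderiv_mlieBracket_of_related {E' : Type*} [NormedAddCommGroup E'] [NormedSpace ℝ E']
    [CompleteSpace E'] {H' : Type*} [TopologicalSpace H'] {I' : ModelWithCorners ℝ E' H'}
    {M' : Type*} [TopologicalSpace M'] [ChartedSpace H' M'] [IsManifold I' ∞ M']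
    {φ : M' → M} (hφ : ContMDiff I' I ∞ φ) {X Y : ∀ x : M, TangentSpace I x}
    {X' Y' : ∀ x : M', TangentSpace I' x} (hX : SmoothVF I X) (hY : SmoothVF I Y)
    (hX' : SmoothVF I' X') (hY' : SmoothVF I' Y')
    (hXX' : ∀ p, mfderiv I' I φ p (X' p) = X (φ p))
    (hYY' : ∀ p, mfderiv I' I φ p (Y' p) = Y (φ p)) (p : M') :
    mfderiv I' I φ p (mlieBracket I' X' Y' p) = mlieBracket I X Y (φ p) := by
  have := FiniteDimensional.complete ℝ E
  refine eq_of_forall_smoothFun_dif_eq fun f hf => ?_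
  have hd {k : M → ℝ} (hk : SmoothFun I k) (p : M') (v : TangentSpace I' p) :
      dif I k (φ p) (mfderiv I' I φ p v) = dif I' (k ∘ φ) p v :=
    (dif_comp_apply hk.mdifferentiableAt (hφ.mdifferentiableAt (by simp)) v).symm
  have hfφ : SmoothFun I' (f ∘ φ) := ContMDiff.comp hf hφ
  rw [hd hf, dif_mlieBracket hX' hY' hfφ, dif_mlieBracket hX hY hf]
  simp only [← hXX', ← hYY', hd (hf.dif_apply hX), hd (hf.dif_apply hY)]
  simp only [Function.comp_def, ← hXX', ← hYY', hd hf]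

end Frame

section Tensoriality

variable {E : Type*} [NormedAddCommGroup E] [NormedSpace ℝ E] {H : Type*} [TopologicalSpace H]
  {I : ModelWithCorners ℝ E H} {M : Type*} [TopologicalSpace M] [ChartedSpace H M]
  {P : ∀ x : M, Bivector (TangentSpace I x)}
  {N : ∀ x : M, TangentSpace I x →L[ℝ] TangentSpace I x}
  {X X' Y Y' : ∀ x : M, TangentSpace I x} {α α' β β' γ : ∀ x : M, TangentSpace I x →L[ℝ] ℝ}
  {f f' g g' h h' : M → ℝ} {x : M}

theorem schoutenBracket_rotate :
    schoutenBracket I P P f g h x = schoutenBracket I P P g h f x := by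
  simp only [schoutenBracket]
  ring

variable (I) in
/-- The Lie derivative `(L_X N)(Y) = [X, N Y] - N [X, Y]` of a `(1,1)`-tensor, evaluated on a vector
field `Y`. -/
def lieDerivEndo (X : ∀ x : M, TangentSpace I x)
    (N : ∀ x : M, TangentSpace I x →L[ℝ] TangentSpace I x) (Y : ∀ x : M, TangentSpace I x) (x : M) :
    TangentSpace I x :=
  mlieBracket I X (fun y => N y (Y y)) x - N x (mlieBracket I X Y x)

theorem nijenhuisTorsion_eq_lieDerivEndo :
    nijenhuisTorsion I N X Y x =
      lieDerivEndo I (fun y => N y (X y)) N Y x - N x (lieDerivEndo I X N Y x) := by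
  simp only [nijenhuisTorsion, lieDerivEndo, map_sub]
  abel

theorem nijenhuisTorsion_swap : nijenhuisTorsion I N X Y x = -nijenhuisTorsion I N Y X x := by
  simp only [nijenhuisTorsion]
  rw [mlieBracket_swap_apply (V := fun y => N y (X y)) (W := fun y => N y (Y y)),
    mlieBracket_swap_apply (V := X) (W := Y), mlieBracket_swap_apply (V := X),
    mlieBracket_swap_apply (W := Y)]
  simp only [map_neg]
  abel

theorem formBracket_swap :
    formBracket I (fun y => (P y).sharp) α β Y x =
      -formBracket I (fun y => (P y).sharp) β α Y x := by
  have hfun : (fun y => β y ((P y).sharp (α y))) = -fun y => α y ((P y).sharp (β y)) :=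
    funext fun y => (P y).eval_swap (α y) (β y)
  simp only [formBracket, hfun, dif_fun_neg, neg_apply]
  ring

/-- The bivector `N ∘ P♯`, for an endomorphism `N` which is self-adjoint with respect to `P`. -/
def Bivector.compEndo {V : Type*} [AddCommGroup V] [Module ℝ V] [TopologicalSpace V]
    [IsTopologicalAddGroup V] (P : Bivector V) (N : V →L[ℝ] V)
    (hPN : ∀ ξ : V →L[ℝ] ℝ, N (P.sharp ξ) = P.sharp (ξ.comp N)) : Bivector V where
  sharp := N.toLinearMap ∘ₗ P.sharp
  alt ξ := by
    have h₁ : ξ (N (P.sharp ξ)) = P.eval (ξ.comp N) ξ := congrArg ξ (hPN ξ)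
    have h₂ : ξ (N (P.sharp ξ)) = -P.eval (ξ.comp N) ξ := P.eval_swap ξ (ξ.comp N)
    exact self_eq_neg.1 (h₁.trans (h₁ ▸ h₂))

theorem formBracket_compEndo
    (hPN : ∀ (x : M) (ξ : TangentSpace I x →L[ℝ] ℝ),
      N x ((P x).sharp ξ) = (P x).sharp (ξ.comp (N x))) (x : M) :
    formBracket I (fun y => ((P y).compEndo (N y) (hPN y)).sharp) α β Y x =
      formBracket I (fun y ξ => N y ((P y).sharp ξ)) α β Y x := rfl

theorem concomitant_swap
    (hPN : ∀ (x : M) (ξ : TangentSpace I x →L[ℝ] ℝ),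
      N x ((P x).sharp ξ) = (P x).sharp (ξ.comp (N x))) :
    concomitant I P N α β Y x = -concomitant I P N β α Y x := by
  simp only [concomitant, ← formBracket_compEndo hPN]
  rw [formBracket_swap (α := α) (β := β), formBracket_swap (α := α) (β := β),
    formBracket_swap (β := β), formBracket_swap (α := α)]
  ring

variable [IsManifold I ∞ M] [FiniteDimensional ℝ E]

theorem lieDerivForm_congr (hβ : SmoothForm I β) (hY : MDiffAt (T% Y) x) (hY' : MDiffAt (T% Y') x)
    (hYY' : Y x = Y' x) : lieDerivForm I X β Y x = lieDerivForm I X β Y' x := by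
  have hΦ : TensorialAt I E (fun Y => lieDerivForm I X β Y x) x := by
    constructor
    · intro f Z hf hZ
      have hfun : (fun y => β y ((f • Z) y)) = f * fun y => β y (Z y) := by ext; simp
      simp only [lieDerivForm, hfun, dif_mul hf (hβ.mdifferentiableAt_apply hZ),
        mlieBracket_smul_right hf hZ, mvfderiv_eq_dif, add_apply, smul_apply, map_add, map_smul,
        smul_eq_mul]
      ring
    · intro Z Z' hZ hZ'
      have hfun : (fun y => β y ((Z + Z') y)) = (fun y => β y (Z y)) + fun y => β y (Z' y) := by
        ext; simp
      simp only [lieDerivForm, hfun, mlieBracket_add_right hZ hZ', add_apply, map_add,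
        dif_add (hβ.mdifferentiableAt_apply hZ) (hβ.mdifferentiableAt_apply hZ')]
      ring
  exact hΦ.pointwise hY hY' hYY'

theorem lieDerivEndo_congr (hN : SmoothEndo I N) (hY : MDiffAt (T% Y) x) (hY' : MDiffAt (T% Y') x)
    (hYY' : Y x = Y' x) : lieDerivEndo I X N Y x = lieDerivEndo I X N Y' x := by
  have hΦ : TensorialAt I E (fun Y => lieDerivEndo I X N Y x) x := by
    constructor
    · intro f Z hf hZ
      have hfun : (fun y => N y ((f • Z) y)) = f • fun y => N y (Z y) := by ext; simp
      simp only [lieDerivEndo, hfun, mlieBracket_smul_right hf hZ,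
        mlieBracket_smul_right hf (hN.mdifferentiableAt_apply hZ), map_add, map_smul]
      module
    · intro Z Z' hZ hZ'
      have hfun : (fun y => N y ((Z + Z') y)) = (fun y => N y (Z y)) + fun y => N y (Z' y) := by
        ext; simp
      simp only [lieDerivEndo, hfun, mlieBracket_add_right hZ hZ', map_add,
        mlieBracket_add_right (hN.mdifferentiableAt_apply hZ) (hN.mdifferentiableAt_apply hZ')]
      abel
  exact hΦ.pointwise hY hY' hYY'

theorem nijenhuisTorsion_congr_right (hN : SmoothEndo I N) (hY : SmoothVF I Y)
    (hY' : SmoothVF I Y') (hYY' : Y x = Y' x) :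
    nijenhuisTorsion I N X Y x = nijenhuisTorsion I N X Y' x := by
  simp only [nijenhuisTorsion_eq_lieDerivEndo,
    lieDerivEndo_congr hN hY.mdifferentiableAt hY'.mdifferentiableAt hYY']

theorem nijenhuisTorsion_congr (hN : SmoothEndo I N) (hX : SmoothVF I X) (hX' : SmoothVF I X')
    (hY : SmoothVF I Y) (hY' : SmoothVF I Y') (hXX' : X x = X' x) (hYY' : Y x = Y' x) :
    nijenhuisTorsion I N X Y x = nijenhuisTorsion I N X' Y' x := by
  rw [nijenhuisTorsion_congr_right hN hY hY' hYY', nijenhuisTorsion_swap,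
    nijenhuisTorsion_congr_right hN hX hX' hXX', ← nijenhuisTorsion_swap]

theorem formBracket_congr_vectorField {R : ∀ x : M, (TangentSpace I x →L[ℝ] ℝ) → TangentSpace I x}
    (hα : SmoothForm I α) (hβ : SmoothForm I β) (hY : SmoothVF I Y) (hY' : SmoothVF I Y')
    (hYY' : Y x = Y' x) : formBracket I R α β Y x = formBracket I R α β Y' x := by
  simp only [formBracket, hYY',
    lieDerivForm_congr hα hY.mdifferentiableAt hY'.mdifferentiableAt hYY',
    lieDerivForm_congr hβ hY.mdifferentiableAt hY'.mdifferentiableAt hYY']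

theorem concomitant_congr_vectorField (hN : SmoothEndo I N) (hα : SmoothForm I α)
    (hβ : SmoothForm I β) (hY : SmoothVF I Y) (hY' : SmoothVF I Y') (hYY' : Y x = Y' x) :
    concomitant I P N α β Y x = concomitant I P N α β Y' x := by
  unfold concomitant
  rw [formBracket_congr_vectorField hα hβ hY hY' hYY',
    formBracket_congr_vectorField (hα.comp hN) hβ hY hY' hYY',
    formBracket_congr_vectorField hα (hβ.comp hN) hY hY' hYY',
    formBracket_congr_vectorField hα hβ (hN.apply hY) (hN.apply hY') (by rw [hYY'])]

variable [T2Space M]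

theorem SmoothBivector.compEndo (hP : SmoothBivector I P) (hN : SmoothEndo I N)
    (hPN : ∀ (x : M) (ξ : TangentSpace I x →L[ℝ] ℝ),
      N x ((P x).sharp ξ) = (P x).sharp (ξ.comp (N x))) :
    SmoothBivector I (fun x => (P x).compEndo (N x) (hPN x)) := fun _ _ hf hh =>
  (hh.smoothForm_dif.comp hN).apply (hP.smoothVF_sharp hf.smoothForm_dif)

theorem schoutenBracket_eq (hP : SmoothBivector I P) (hf : SmoothFun I f) (hg : SmoothFun I g)
    (hh : SmoothFun I h) :
    schoutenBracket I P P f g h x = 2 * dif I f x ((P x).sharp (dif I (bivectorBracket I P g h) x)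
      - mlieBracket I (fun y => (P y).sharp (dif I g y)) (fun y => (P y).sharp (dif I h y)) x) := by
  have := FiniteDimensional.complete ℝ E
  have hgh : bivectorBracket I P (bivectorBracket I P g h) f x
      = dif I f x ((P x).sharp (dif I (bivectorBracket I P g h) x)) := rfl
  have hfg : bivectorBracket I P (bivectorBracket I P f g) h x
      = dif I (fun y => dif I f y ((P y).sharp (dif I g y))) x ((P x).sharp (dif I h x)) := by
    have hswap : bivectorBracket I P f g = -fun y => dif I f y ((P y).sharp (dif I g y)) :=
      funext fun y => (P y).eval_swap _ _
    rw [bivectorBracket, Bivector.eval_swap, hswap, dif_fun_neg]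
    simp [Bivector.eval]
  have hhf : bivectorBracket I P (bivectorBracket I P h f) g x
      = -dif I (fun y => dif I f y ((P y).sharp (dif I h y))) x ((P x).sharp (dif I g x)) := by
    rw [bivectorBracket, Bivector.eval_swap]
    rfl
  rw [map_sub, dif_mlieBracket (hP.smoothVF_sharp hg.smoothForm_dif)
    (hP.smoothVF_sharp hh.smoothForm_dif) hf]
  simp only [schoutenBracket, hgh, hfg, hhf]
  ring

theorem schoutenBracket_congr_left (hP : SmoothBivector I P) (hf : SmoothFun I f)
    (hf' : SmoothFun I f') (hg : SmoothFun I g) (hh : SmoothFun I h)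
    (hff' : dif I f x = dif I f' x) :
    schoutenBracket I P P f g h x = schoutenBracket I P P f' g h x := by
  rw [schoutenBracket_eq hP hf hg hh, schoutenBracket_eq hP hf' hg hh, hff']

theorem schoutenBracket_congr (hP : SmoothBivector I P) (hf : SmoothFun I f)
    (hf' : SmoothFun I f') (hg : SmoothFun I g) (hg' : SmoothFun I g') (hh : SmoothFun I h)
    (hh' : SmoothFun I h') (hff' : dif I f x = dif I f' x) (hgg' : dif I g x = dif I g' x)
    (hhh' : dif I h x = dif I h' x) :
    schoutenBracket I P P f g h x = schoutenBracket I P P f' g' h' x := by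
  rw [schoutenBracket_congr_left hP hf hf' hg hh hff', schoutenBracket_rotate,
    schoutenBracket_congr_left hP hg hg' hh hf' hgg', schoutenBracket_rotate,
    schoutenBracket_congr_left hP hh hh' hf' hg' hhh', schoutenBracket_rotate]

theorem formBracket_add_right (hP : SmoothBivector I P) (hα : SmoothForm I α) (hβ : SmoothForm I β)
    (hγ : SmoothForm I γ) (hY : SmoothVF I Y) :
    formBracket I (fun y => (P y).sharp) α (β + γ) Y x =
      formBracket I (fun y => (P y).sharp) α β Y x
        + formBracket I (fun y => (P y).sharp) α γ Y x := by
  have hsharp : (fun y => (P y).sharp ((β + γ) y)) =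
      (fun y => (P y).sharp (β y)) + fun y => (P y).sharp (γ y) := by
    ext; simp
  have happly (Z : ∀ x : M, TangentSpace I x) :
      (fun y => (β + γ) y (Z y)) = (fun y => β y (Z y)) + fun y => γ y (Z y) := by
    ext; simp
  have hPα := hP.smoothVF_sharp hα
  unfold formBracket lieDerivForm
  rw [hsharp, happly Y, happly, mlieBracket_add_left (hP.smoothVF_sharp hβ).mdifferentiableAt
      (hP.smoothVF_sharp hγ).mdifferentiableAt,
    dif_add (hβ.apply hY).mdifferentiableAt (hγ.apply hY).mdifferentiableAt,
    dif_add (hβ.apply hPα).mdifferentiableAt (hγ.apply hPα).mdifferentiableAt]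
  simp only [Pi.add_apply, add_apply, map_add]
  ring

/- Where `γ` vanishes, tensoriality of `L_Y α` turns `α([P♯γ, Y])` into `Y(α(P♯γ))`, which is
`-Y(γ(P♯α))` and cancels against the last term of the bracket. -/
theorem formBracket_of_eq_zero (hP : SmoothBivector I P) (hα : SmoothForm I α)
    (hγ : SmoothForm I γ) (hγx : γ x = 0) :
    formBracket I (fun y => (P y).sharp) α γ Y x =
      dif I (fun y => γ y (Y y)) x ((P x).sharp (α x)) := by
  have hPγ : (P x).sharp (γ x) = 0 := by rw [hγx, map_zero]
  have htensor : lieDerivForm I Y α (fun y => (P y).sharp (γ y)) x = 0 := by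
    rw [lieDerivForm_congr (Y' := 0) hα (hP.smoothVF_sharp hγ).mdifferentiableAt
      (Bundle.mdifferentiable_zeroSection ℝ (TangentSpace I) x) hPγ, lieDerivForm]
    have hfun : (fun y => α y ((0 : ∀ y : M, TangentSpace I y) y)) = 0 := by ext; simp
    rw [hfun, dif_zero, mlieBracket_zero_right, Pi.zero_apply, map_zero, zero_apply, sub_zero]
  have hfun : (fun y => γ y ((P y).sharp (α y))) = -fun y => α y ((P y).sharp (γ y)) :=
    funext fun y => (P y).eval_swap (α y) (γ y)
  simp only [lieDerivForm] at htensor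
  simp only [formBracket, lieDerivForm, hfun, hγx, dif_fun_neg,
    mlieBracket_swap_apply (W := Y), zero_apply, neg_apply, map_zero, map_neg]
  linarith

section Concomitant

variable (hP : SmoothBivector I P) (hN : SmoothEndo I N)
  (hPN : ∀ (x : M) (ξ : TangentSpace I x →L[ℝ] ℝ),
    N x ((P x).sharp ξ) = (P x).sharp (ξ.comp (N x)))
include hP hN hPN

theorem concomitant_add_right (hα : SmoothForm I α) (hβ : SmoothForm I β) (hγ : SmoothForm I γ)
    (hY : SmoothVF I Y) :
    concomitant I P N α (β + γ) Y x = concomitant I P N α β Y x + concomitant I P N α γ Y x := by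
  have hcomp : (fun y => ((β + γ) y).comp (N y)) =
      (fun y => (β y).comp (N y)) + fun y => (γ y).comp (N y) := by
    ext; simp
  simp only [concomitant, ← formBracket_compEndo hPN, hcomp,
    formBracket_add_right (hP.compEndo hN hPN) hα hβ hγ hY,
    formBracket_add_right hP (hα.comp hN) hβ hγ hY,
    formBracket_add_right hP hα (hβ.comp hN) (hγ.comp hN) hY,
    formBracket_add_right hP hα hβ hγ (hN.apply hY)]
  ring

theorem concomitant_of_eq_zero (hα : SmoothForm I α) (hγ : SmoothForm I γ) (hγx : γ x = 0) :
    concomitant I P N α γ Y x = 0 := by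
  have hγN : (γ x).comp (N x) = 0 := by rw [hγx, ContinuousLinearMap.zero_comp]
  simp only [concomitant, ← formBracket_compEndo hPN]
  rw [formBracket_of_eq_zero (hP.compEndo hN hPN) hα hγ hγx,
    formBracket_of_eq_zero hP (hα.comp hN) hγ hγx,
    formBracket_of_eq_zero hP hα (hγ.comp hN) hγN, formBracket_of_eq_zero hP hα hγ hγx, ← hPN]
  exact sub_eq_zero.2 (by simp [Bivector.compEndo])

theorem concomitant_congr_right (hα : SmoothForm I α) (hβ : SmoothForm I β)
    (hβ' : SmoothForm I β') (hY : SmoothVF I Y) (hββ' : β x = β' x) :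
    concomitant I P N α β Y x = concomitant I P N α β' Y x := by
  have hsub : SmoothForm I (β - β') := hβ.sub hβ'
  rw [← add_sub_cancel β' β, concomitant_add_right hP hN hPN hα hβ' hsub hY,
    concomitant_of_eq_zero hP hN hPN hα hsub (sub_eq_zero.2 hββ'), add_zero]

theorem concomitant_congr (hα : SmoothForm I α) (hα' : SmoothForm I α') (hβ : SmoothForm I β)
    (hβ' : SmoothForm I β') (hY : SmoothVF I Y) (hY' : SmoothVF I Y') (hαα' : α x = α' x)
    (hββ' : β x = β' x) (hYY' : Y x = Y' x) :
    concomitant I P N α β Y x = concomitant I P N α' β' Y' x := by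
  rw [concomitant_congr_right hP hN hPN hα hβ hβ' hY hββ', concomitant_swap hPN,
    concomitant_congr_right hP hN hPN hβ' hα hα' hY hαα', ← concomitant_swap hPN,
    concomitant_congr_vectorField hN hα' hβ' hY hY' hYY']

end Concomitant

end Tensoriality

section DirectSum

variable {E : Type*} [NormedAddCommGroup E] [NormedSpace ℝ E] {H : Type*} [TopologicalSpace H]
  {I : ModelWithCorners ℝ E H} {M : Type*} [TopologicalSpace M] [ChartedSpace H M]
  {F : Type*} [NormedAddCommGroup F] [NormedSpace ℝ F] {K : Type*} [TopologicalSpace K]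
  {J : ModelWithCorners ℝ F K} {Q : Type*} [TopologicalSpace Q] [ChartedSpace K Q]

/-- The direct sum `f ⊕ g` of two functions, `(x, q) ↦ f x + g q`, with `d(f ⊕ g) = df ⊕ dg`. -/
def sumFun (f : M → ℝ) (g : Q → ℝ) (p : M × Q) : ℝ := f p.1 + g p.2

/-- The direct sum `X ⊕ Y` of two vector fields, as a vector field on the product. -/
def sumVF (X : ∀ x : M, TangentSpace I x) (Y : ∀ q : Q, TangentSpace J q) (p : M × Q) :
    TangentSpace (I.prod J) p := (X p.1, Y p.2)

/-- The direct sum `α ⊕ β = pr₁* α + pr₂* β` of two one-forms. -/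
def sumForm (α : ∀ x : M, TangentSpace I x →L[ℝ] ℝ) (β : ∀ q : Q, TangentSpace J q →L[ℝ] ℝ)
    (p : M × Q) : TangentSpace (I.prod J) p →L[ℝ] ℝ := (α p.1).coprod (β p.2)

/-- The direct sum `N ⊕ L` of two `(1,1)`-tensors. -/
def sumEndo (N : ∀ x : M, TangentSpace I x →L[ℝ] TangentSpace I x)
    (L : ∀ q : Q, TangentSpace J q →L[ℝ] TangentSpace J q) (p : M × Q) :
    TangentSpace (I.prod J) p →L[ℝ] TangentSpace (I.prod J) p := (N p.1).prodMap (L p.2)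

/-- The direct sum `P ⊕ S` of two bivector fields. -/
def sumBivector (P : ∀ x : M, Bivector (TangentSpace I x))
    (S : ∀ q : Q, Bivector (TangentSpace J q)) (p : M × Q) : Bivector (TangentSpace (I.prod J) p) :=
  (P p.1).prod (S p.2)

/-- The restriction of a covector at `(x, q)` to the first factor `T_x M`. -/
def coFst {p : M × Q} (ξ : TangentSpace (I.prod J) p →L[ℝ] ℝ) : TangentSpace I p.1 →L[ℝ] ℝ :=
  ξ.comp (ContinuousLinearMap.inl ℝ (TangentSpace I p.1) (TangentSpace J p.2))

/-- The restriction of a covector at `(x, q)` to the second factor `T_q Q`. -/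
def coSnd {p : M × Q} (ξ : TangentSpace (I.prod J) p →L[ℝ] ℝ) : TangentSpace J p.2 →L[ℝ] ℝ :=
  ξ.comp (ContinuousLinearMap.inr ℝ (TangentSpace I p.1) (TangentSpace J p.2))

section Pointwise

variable {α : ∀ x : M, TangentSpace I x →L[ℝ] ℝ} {β : ∀ q : Q, TangentSpace J q →L[ℝ] ℝ}
  {N : ∀ x : M, TangentSpace I x →L[ℝ] TangentSpace I x}
  {L : ∀ q : Q, TangentSpace J q →L[ℝ] TangentSpace J q}
  {f : M → ℝ} {g : Q → ℝ} {p : M × Q}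

theorem coFst_sumForm : coFst (sumForm α β p) = α p.1 :=
  ContinuousLinearMap.coprod_comp_inl _ _

theorem coSnd_sumForm : coSnd (sumForm α β p) = β p.2 :=
  ContinuousLinearMap.coprod_comp_inr _ _

theorem sumForm_slices (α : ∀ p : M × Q, TangentSpace (I.prod J) p →L[ℝ] ℝ) (p : M × Q) :
    sumForm (fun x => coFst (α (x, p.2))) (fun q => coSnd (α (p.1, q))) p = α p :=
  ContinuousLinearMap.coprod_comp_inl_inr (α p)

theorem covector_apply_eq_add (ξ : TangentSpace (I.prod J) p →L[ℝ] ℝ)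
    (v : TangentSpace (I.prod J) p) : ξ v = coFst ξ v.1 + coSnd ξ v.2 :=
  congrArg (fun ζ : TangentSpace (I.prod J) p →L[ℝ] ℝ => ζ v)
    (ContinuousLinearMap.coprod_comp_inl_inr ξ).symm

theorem sumForm_comp_sumEndo (α : ∀ x : M, TangentSpace I x →L[ℝ] ℝ)
    (β : ∀ q : Q, TangentSpace J q →L[ℝ] ℝ) (p : M × Q) :
    (sumForm α β p).comp (sumEndo N L p) =
      sumForm (fun x => (α x).comp (N x)) (fun q => (β q).comp (L q)) p :=
  ContinuousLinearMap.ext fun _ => rfl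

theorem coFst_comp_sumEndo (ξ : TangentSpace (I.prod J) p →L[ℝ] ℝ) :
    coFst (ξ.comp (sumEndo N L p)) = (coFst ξ).comp (N p.1) :=
  ContinuousLinearMap.ext fun v =>
    congrArg (fun w => ξ ((N p.1 v, w) : TangentSpace I p.1 × TangentSpace J p.2))
      (map_zero (L p.2))

theorem coSnd_comp_sumEndo (ξ : TangentSpace (I.prod J) p →L[ℝ] ℝ) :
    coSnd (ξ.comp (sumEndo N L p)) = (coSnd ξ).comp (L p.2) :=
  ContinuousLinearMap.ext fun w =>
    congrArg (fun v => ξ ((v, L p.2 w) : TangentSpace I p.1 × TangentSpace J p.2))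
      (map_zero (N p.1))

theorem dif_sumFun (hf : MDiffAt f p.1) (hg : MDiffAt g p.2) :
    dif (I.prod J) (sumFun f g) p = sumForm (dif I f) (dif J g) p := by
  have hf' : MDifferentiableAt (I.prod J) 𝓘(ℝ, ℝ) (f ∘ Prod.fst) p :=
    hf.comp p mdifferentiableAt_fst
  have hg' : MDifferentiableAt (I.prod J) 𝓘(ℝ, ℝ) (g ∘ Prod.snd) p :=
    hg.comp p mdifferentiableAt_snd
  ext v
  change dif (I.prod J) (f ∘ Prod.fst + g ∘ Prod.snd) p v = _
  rw [dif_add hf' hg', add_apply, dif_comp_apply hf mdifferentiableAt_fst,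
    dif_comp_apply hg mdifferentiableAt_snd, mfderiv_fst, mfderiv_snd]
  rfl

theorem dif_sumFun_slices {f : M × Q → ℝ} (hf : SmoothFun (I.prod J) f) (p : M × Q) :
    dif (I.prod J) (sumFun (fun x => f (x, p.2)) fun q => f (p.1, q)) p = dif (I.prod J) f p := by
  have hf₁ : MDiffAt (fun x => f (x, p.2)) p.1 :=
    hf.mdifferentiableAt.comp p.1 (mdifferentiableAt_id.prodMk mdifferentiableAt_const)
  have hf₂ : MDiffAt (fun q => f (p.1, q)) p.2 :=
    hf.mdifferentiableAt.comp p.2 (mdifferentiableAt_const.prodMk mdifferentiableAt_id)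
  rw [dif_sumFun hf₁ hf₂]
  ext v
  exact (mfderiv_prod_eq_add_apply hf.mdifferentiableAt).symm

end Pointwise

section Smoothness

variable {f : M → ℝ} {g : Q → ℝ}

theorem SmoothFun.sumFun (hf : SmoothFun I f) (hg : SmoothFun J g) :
    SmoothFun (I.prod J) (sumFun f g) :=
  (ContMDiff.comp hf contMDiff_fst).add (ContMDiff.comp hg contMDiff_snd)

theorem SmoothFun.slice_fst {f : M × Q → ℝ} (hf : SmoothFun (I.prod J) f) (q : Q) :
    SmoothFun I (fun x => f (x, q)) :=
  ContMDiff.comp (g := f) hf (contMDiff_id.prodMk contMDiff_const)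

theorem SmoothFun.slice_snd {f : M × Q → ℝ} (hf : SmoothFun (I.prod J) f) (x : M) :
    SmoothFun J (fun q => f (x, q)) :=
  ContMDiff.comp (g := f) hf (contMDiff_const.prodMk contMDiff_id)

variable [IsManifold I ∞ M] [IsManifold J ∞ Q]

theorem contMDiffAt_tangentBundle_prodMk {D : Type*} [NormedAddCommGroup D] [NormedSpace ℝ D]
    {L : Type*} [TopologicalSpace L] {R : ModelWithCorners ℝ D L} {Z : Type*} [TopologicalSpace Z]
    [ChartedSpace L Z] {n : WithTop ℕ∞} {a : Z → M} {b : Z → Q} {u : ∀ z, TangentSpace I (a z)}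
    {w : ∀ z, TangentSpace J (b z)} {z : Z}
    (hu : ContMDiffAt R I.tangent n (fun z => (⟨a z, u z⟩ : TangentBundle I M)) z)
    (hw : ContMDiffAt R J.tangent n (fun z => (⟨b z, w z⟩ : TangentBundle J Q)) z) :
    ContMDiffAt R (I.prod J).tangent n
      (fun z => (⟨(a z, b z), (u z, w z)⟩ : TangentBundle (I.prod J) (M × Q))) z :=
  (contMDiff_equivTangentBundleProd_symm (I := I) (I' := J) (M := M) (M' := Q)).contMDiffAt.comp z
    (hu.prodMk hw)

theorem contMDiff_tangentBundle_fst {n : WithTop ℕ∞} : ContMDiff (I.prod J).tangent I.tangent n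
    (fun v : TangentBundle (I.prod J) (M × Q) => (⟨v.1.1, v.2.1⟩ : TangentBundle I M)) :=
  contMDiff_fst.comp (contMDiff_equivTangentBundleProd (I := I) (I' := J) (M := M) (M' := Q))

theorem contMDiff_tangentBundle_snd {n : WithTop ℕ∞} : ContMDiff (I.prod J).tangent J.tangent n
    (fun v : TangentBundle (I.prod J) (M × Q) => (⟨v.1.2, v.2.2⟩ : TangentBundle J Q)) :=
  contMDiff_snd.comp (contMDiff_equivTangentBundleProd (I := I) (I' := J) (M := M) (M' := Q))

theorem contMDiff_tangentBundle_zero {D : Type*} [NormedAddCommGroup D] [NormedSpace ℝ D]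
    {L : Type*} [TopologicalSpace L] {R : ModelWithCorners ℝ D L} {Z : Type*} [TopologicalSpace Z]
    [ChartedSpace L Z] {n : WithTop ℕ∞} {a : Z → M} (ha : ContMDiff R I n a) :
    ContMDiff R I.tangent n (fun z => (⟨a z, 0⟩ : TangentBundle I M)) :=
  (Bundle.contMDiff_zeroSection ℝ (TangentSpace I : M → Type _)).comp ha

theorem SmoothVF.sumVF {X : ∀ x : M, TangentSpace I x} {Y : ∀ q : Q, TangentSpace J q}
    (hX : SmoothVF I X) (hY : SmoothVF J Y) : SmoothVF (I.prod J) (sumVF X Y) := fun p =>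
  contMDiffAt_tangentBundle_prodMk ((ContMDiff.comp hX contMDiff_fst) p)
    ((ContMDiff.comp hY contMDiff_snd) p)

theorem SmoothVF.slice_fst {X : ∀ p : M × Q, TangentSpace (I.prod J) p}
    (hX : SmoothVF (I.prod J) X) (q : Q) : SmoothVF I (fun x => (X (x, q)).1) :=
  contMDiff_tangentBundle_fst.comp (ContMDiff.comp hX (contMDiff_id.prodMk contMDiff_const))

theorem SmoothVF.slice_snd {X : ∀ p : M × Q, TangentSpace (I.prod J) p}
    (hX : SmoothVF (I.prod J) X) (x : M) : SmoothVF J (fun q => (X (x, q)).2) :=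
  contMDiff_tangentBundle_snd.comp (ContMDiff.comp hX (contMDiff_const.prodMk contMDiff_id))

theorem SmoothForm.sumForm {α : ∀ x : M, TangentSpace I x →L[ℝ] ℝ}
    {β : ∀ q : Q, TangentSpace J q →L[ℝ] ℝ} (hα : SmoothForm I α) (hβ : SmoothForm J β) :
    SmoothForm (I.prod J) (sumForm α β) :=
  (ContMDiff.comp (g := fun v : TangentBundle I M => α v.1 v.2) hα contMDiff_tangentBundle_fst).add
    (ContMDiff.comp (g := fun v : TangentBundle J Q => β v.1 v.2) hβ contMDiff_tangentBundle_snd)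

theorem SmoothForm.slice_fst {α : ∀ p : M × Q, TangentSpace (I.prod J) p →L[ℝ] ℝ}
    (hα : SmoothForm (I.prod J) α) (q : Q) : SmoothForm I (fun x => coFst (α (x, q))) :=
  ContMDiff.comp (g := fun v : TangentBundle (I.prod J) (M × Q) => α v.1 v.2) hα fun v =>
    contMDiffAt_tangentBundle_prodMk contMDiffAt_id (contMDiff_tangentBundle_zero contMDiff_const v)

theorem SmoothForm.slice_snd {α : ∀ p : M × Q, TangentSpace (I.prod J) p →L[ℝ] ℝ}
    (hα : SmoothForm (I.prod J) α) (x : M) : SmoothForm J (fun q => coSnd (α (x, q))) :=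
  ContMDiff.comp (g := fun v : TangentBundle (I.prod J) (M × Q) => α v.1 v.2) hα fun v =>
    contMDiffAt_tangentBundle_prodMk (contMDiff_tangentBundle_zero contMDiff_const v) contMDiffAt_id

theorem SmoothEndo.sumEndo {N : ∀ x : M, TangentSpace I x →L[ℝ] TangentSpace I x}
    {L : ∀ q : Q, TangentSpace J q →L[ℝ] TangentSpace J q} (hN : SmoothEndo I N)
    (hL : SmoothEndo J L) : SmoothEndo (I.prod J) (sumEndo N L) := fun v =>
  contMDiffAt_tangentBundle_prodMk
    (ContMDiff.comp (g := fun v : TangentBundle I M => (⟨v.1, N v.1 v.2⟩ : TangentBundle I M)) hN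
      contMDiff_tangentBundle_fst v)
    (ContMDiff.comp (g := fun v : TangentBundle J Q => (⟨v.1, L v.1 v.2⟩ : TangentBundle J Q)) hL
      contMDiff_tangentBundle_snd v)

end Smoothness

section Splitting

variable {P : ∀ x : M, Bivector (TangentSpace I x)} {S : ∀ q : Q, Bivector (TangentSpace J q)}
  {N : ∀ x : M, TangentSpace I x →L[ℝ] TangentSpace I x}
  {L : ∀ q : Q, TangentSpace J q →L[ℝ] TangentSpace J q}
  {X Y : ∀ x : M, TangentSpace I x} {X' Y' : ∀ q : Q, TangentSpace J q}
  {α β : ∀ x : M, TangentSpace I x →L[ℝ] ℝ} {α' β' : ∀ q : Q, TangentSpace J q →L[ℝ] ℝ}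
  {f g h : M → ℝ} {f' g' h' : Q → ℝ} {p : M × Q}

theorem bivectorBracket_sumBivector (hf : SmoothFun I f) (hf' : SmoothFun J f')
    (hg : SmoothFun I g) (hg' : SmoothFun J g') :
    bivectorBracket (I.prod J) (sumBivector P S) (sumFun f f') (sumFun g g') =
      sumFun (bivectorBracket I P f g) (bivectorBracket J S f' g') := by
  funext p
  rw [bivectorBracket, dif_sumFun hf.mdifferentiableAt hf'.mdifferentiableAt,
    dif_sumFun hg.mdifferentiableAt hg'.mdifferentiableAt]
  change sumForm (dif I g) (dif J g') p
    ((P p.1).sharp (coFst (sumForm (dif I f) (dif J f') p)),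
      (S p.2).sharp (coSnd (sumForm (dif I f) (dif J f') p))) = _
  rw [coFst_sumForm, coSnd_sumForm]
  rfl

theorem schoutenBracket_sumBivector (hP : SmoothBivector I P) (hS : SmoothBivector J S)
    (hf : SmoothFun I f) (hf' : SmoothFun J f') (hg : SmoothFun I g) (hg' : SmoothFun J g')
    (hh : SmoothFun I h) (hh' : SmoothFun J h') :
    schoutenBracket (I.prod J) (sumBivector P S) (sumBivector P S) (sumFun f f') (sumFun g g')
        (sumFun h h') p =
      schoutenBracket I P P f g h p.1 + schoutenBracket J S S f' g' h' p.2 := by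
  simp only [schoutenBracket]
  rw [bivectorBracket_sumBivector hf hf' hg hg', bivectorBracket_sumBivector hg hg' hh hh',
    bivectorBracket_sumBivector hh hh' hf hf',
    bivectorBracket_sumBivector (hP _ _ hf hg) (hS _ _ hf' hg') hh hh',
    bivectorBracket_sumBivector (hP _ _ hg hh) (hS _ _ hg' hh') hf hf',
    bivectorBracket_sumBivector (hP _ _ hh hf) (hS _ _ hh' hf') hg hg']
  simp only [sumFun]
  ring

variable [IsManifold I ∞ M] [IsManifold J ∞ Q] [FiniteDimensional ℝ E] [T2Space M]
  [FiniteDimensional ℝ F] [T2Space Q]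

theorem mlieBracket_sumVF (hX : SmoothVF I X) (hX' : SmoothVF J X') (hY : SmoothVF I Y)
    (hY' : SmoothVF J Y') :
    mlieBracket (I.prod J) (sumVF X X') (sumVF Y Y') =
      sumVF (mlieBracket I X Y) (mlieBracket J X' Y') := by
  have := FiniteDimensional.complete ℝ E
  have := FiniteDimensional.complete ℝ F
  funext p
  have hfst := mfderiv_mlieBracket_of_related (I := I) (M := M) contMDiff_fst hX hY (hX.sumVF hX')
    (hY.sumVF hY') (fun p => by rw [mfderiv_fst]; rfl) (fun p => by rw [mfderiv_fst]; rfl) p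
  have hsnd := mfderiv_mlieBracket_of_related (I := J) (M := Q) contMDiff_snd hX' hY'
    (hX.sumVF hX') (hY.sumVF hY') (fun p => by rw [mfderiv_snd]; rfl)
    (fun p => by rw [mfderiv_snd]; rfl) p
  rw [mfderiv_fst] at hfst
  rw [mfderiv_snd] at hsnd
  exact Prod.ext hfst hsnd

theorem nijenhuisTorsion_sumEndo (hN : SmoothEndo I N) (hL : SmoothEndo J L) (hX : SmoothVF I X)
    (hX' : SmoothVF J X') (hY : SmoothVF I Y) (hY' : SmoothVF J Y') :
    nijenhuisTorsion (I.prod J) (sumEndo N L) (sumVF X X') (sumVF Y Y') =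
      sumVF (nijenhuisTorsion I N X Y) (nijenhuisTorsion J L X' Y') := by
  funext p
  have hNL (Z : ∀ x : M, TangentSpace I x) (Z' : ∀ q : Q, TangentSpace J q) :
      (fun p => sumEndo N L p (sumVF Z Z' p)) =
        sumVF (fun x => N x (Z x)) fun q => L q (Z' q) := rfl
  simp only [nijenhuisTorsion, hNL]
  rw [mlieBracket_sumVF (hN.apply hX) (hL.apply hX') (hN.apply hY) (hL.apply hY'),
    mlieBracket_sumVF (hN.apply hX) (hL.apply hX') hY hY',
    mlieBracket_sumVF hX hX' (hN.apply hY) (hL.apply hY'), mlieBracket_sumVF hX hX' hY hY']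
  rfl

theorem lieDerivForm_sumForm (hβ : SmoothForm I β) (hβ' : SmoothForm J β') (hX : SmoothVF I X)
    (hX' : SmoothVF J X') (hY : SmoothVF I Y) (hY' : SmoothVF J Y') :
    lieDerivForm (I.prod J) (sumVF X X') (sumForm β β') (sumVF Y Y') p =
      lieDerivForm I X β Y p.1 + lieDerivForm J X' β' Y' p.2 := by
  have hβY : (fun p => sumForm β β' p (sumVF Y Y' p)) =
      sumFun (fun x => β x (Y x)) fun q => β' q (Y' q) := rfl
  rw [lieDerivForm, hβY,
    dif_sumFun (hβ.apply hY).mdifferentiableAt (hβ'.apply hY').mdifferentiableAt,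
    mlieBracket_sumVF hX hX' hY hY']
  exact add_sub_add_comm _ _ _ _

theorem formBracket_sumForm {R : ∀ x : M, (TangentSpace I x →L[ℝ] ℝ) → TangentSpace I x}
    {T : ∀ q : Q, (TangentSpace J q →L[ℝ] ℝ) → TangentSpace J q}
    (hα : SmoothForm I α) (hα' : SmoothForm J α') (hβ : SmoothForm I β) (hβ' : SmoothForm J β')
    (hRα : SmoothVF I fun x => R x (α x)) (hTα' : SmoothVF J fun q => T q (α' q))
    (hRβ : SmoothVF I fun x => R x (β x)) (hTβ' : SmoothVF J fun q => T q (β' q))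
    (hY : SmoothVF I Y) (hY' : SmoothVF J Y') :
    formBracket (I.prod J) (fun p ξ => (R p.1 (coFst ξ), T p.2 (coSnd ξ))) (sumForm α α')
        (sumForm β β') (sumVF Y Y') p =
      formBracket I R α β Y p.1 + formBracket J T α' β' Y' p.2 := by
  have hRT (γ : ∀ x : M, TangentSpace I x →L[ℝ] ℝ) (γ' : ∀ q : Q, TangentSpace J q →L[ℝ] ℝ) :
      (fun p => ((R p.1 (coFst (sumForm γ γ' p)), T p.2 (coSnd (sumForm γ γ' p))) :
        TangentSpace (I.prod J) p)) = sumVF (fun x => R x (γ x)) fun q => T q (γ' q) := by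
    simp only [coFst_sumForm, coSnd_sumForm]
    rfl
  have hβRT : (fun p => sumForm β β' p (R p.1 (coFst (sumForm α α' p)),
        T p.2 (coSnd (sumForm α α' p)))) =
      sumFun (fun x => β x (R x (α x))) fun q => β' q (T q (α' q)) := by
    simp only [coFst_sumForm, coSnd_sumForm]
    rfl
  unfold formBracket
  rw [hRT, hRT, hβRT, lieDerivForm_sumForm hβ hβ' hRα hTα' hY hY',
    lieDerivForm_sumForm hα hα' hRβ hTβ' hY hY',
    dif_sumFun (hβ.apply hRα).mdifferentiableAt (hβ'.apply hTα').mdifferentiableAt]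
  change _ - _ - (dif I _ p.1 (Y p.1) + dif J _ p.2 (Y' p.2)) = _
  ring

theorem formBracket_sumBivector (hP : SmoothBivector I P) (hS : SmoothBivector J S)
    (hα : SmoothForm I α) (hα' : SmoothForm J α') (hβ : SmoothForm I β) (hβ' : SmoothForm J β')
    (hY : SmoothVF I Y) (hY' : SmoothVF J Y') :
    formBracket (I.prod J) (fun p => (sumBivector P S p).sharp) (sumForm α α') (sumForm β β')
        (sumVF Y Y') p =
      formBracket I (fun x => (P x).sharp) α β Y p.1 +
        formBracket J (fun q => (S q).sharp) α' β' Y' p.2 :=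
  formBracket_sumForm (R := fun x ξ => (P x).sharp ξ) (T := fun q ξ => (S q).sharp ξ) hα hα' hβ hβ'
    (hP.smoothVF_sharp hα) (hS.smoothVF_sharp hα') (hP.smoothVF_sharp hβ) (hS.smoothVF_sharp hβ')
    hY hY'

theorem formBracket_sumEndo_sumBivector (hP : SmoothBivector I P) (hS : SmoothBivector J S)
    (hN : SmoothEndo I N) (hL : SmoothEndo J L) (hα : SmoothForm I α) (hα' : SmoothForm J α')
    (hβ : SmoothForm I β) (hβ' : SmoothForm J β') (hY : SmoothVF I Y) (hY' : SmoothVF J Y') :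
    formBracket (I.prod J) (fun p ξ => sumEndo N L p ((sumBivector P S p).sharp ξ)) (sumForm α α')
        (sumForm β β') (sumVF Y Y') p =
      formBracket I (fun x ξ => N x ((P x).sharp ξ)) α β Y p.1 +
        formBracket J (fun q ξ => L q ((S q).sharp ξ)) α' β' Y' p.2 :=
  formBracket_sumForm (R := fun x ξ => N x ((P x).sharp ξ)) (T := fun q ξ => L q ((S q).sharp ξ))
    hα hα' hβ hβ' (hN.apply (hP.smoothVF_sharp hα)) (hL.apply (hS.smoothVF_sharp hα'))
    (hN.apply (hP.smoothVF_sharp hβ)) (hL.apply (hS.smoothVF_sharp hβ')) hY hY'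

theorem concomitant_sumBivector (hP : SmoothBivector I P) (hS : SmoothBivector J S)
    (hN : SmoothEndo I N) (hL : SmoothEndo J L) (hα : SmoothForm I α) (hα' : SmoothForm J α')
    (hβ : SmoothForm I β) (hβ' : SmoothForm J β') (hY : SmoothVF I Y) (hY' : SmoothVF J Y') :
    concomitant (I.prod J) (sumBivector P S) (sumEndo N L) (sumForm α α') (sumForm β β')
        (sumVF Y Y') p =
      concomitant I P N α β Y p.1 + concomitant J S L α' β' Y' p.2 := by
  have hNL (γ : ∀ x : M, TangentSpace I x →L[ℝ] ℝ) (γ' : ∀ q : Q, TangentSpace J q →L[ℝ] ℝ) :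
      (fun p => (sumForm γ γ' p).comp (sumEndo N L p)) =
        sumForm (fun x => (γ x).comp (N x)) fun q => (γ' q).comp (L q) :=
    funext fun p => sumForm_comp_sumEndo γ γ' p
  have hYNL : (fun p => sumEndo N L p (sumVF Y Y' p)) =
      sumVF (fun x => N x (Y x)) fun q => L q (Y' q) := rfl
  simp only [concomitant, hNL, hYNL]
  rw [formBracket_sumEndo_sumBivector hP hS hN hL hα hα' hβ hβ' hY hY',
    formBracket_sumBivector hP hS (hα.comp hN) (hα'.comp hL) hβ hβ' hY hY',
    formBracket_sumBivector hP hS hα hα' (hβ.comp hN) (hβ'.comp hL) hY hY',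
    formBracket_sumBivector hP hS hα hα' hβ hβ' (hN.apply hY) (hL.apply hY')]
  ring

end Splitting

section Structures

variable [IsManifold I ∞ M] [IsManifold J ∞ Q] [FiniteDimensional ℝ E] [T2Space M]
  [FiniteDimensional ℝ F] [T2Space Q]
  {P : ∀ x : M, Bivector (TangentSpace I x)} {S : ∀ q : Q, Bivector (TangentSpace J q)}
  {N : ∀ x : M, TangentSpace I x →L[ℝ] TangentSpace I x}
  {L : ∀ q : Q, TangentSpace J q →L[ℝ] TangentSpace J q}

theorem SmoothBivector.sum (hP : SmoothBivector I P) (hS : SmoothBivector J S) :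
    SmoothBivector (I.prod J) (sumBivector P S) := by
  intro f h hf hh p
  have hfst {k : M × Q → ℝ} (hk : SmoothFun (I.prod J) k) (X : ∀ x : M, TangentSpace I x)
      (hX : ContMDiffAt I I.tangent ∞ (T% X) p.1) :
      ContMDiffAt (I.prod J) 𝓘(ℝ, ℝ) ∞ (fun z => coFst (dif (I.prod J) k z) (X z.1)) p :=
    ContMDiffAt.comp (g := fun v : TangentBundle (I.prod J) (M × Q) => dif (I.prod J) k v.1 v.2)
      p hk.smoothForm_dif.contMDiffAt (contMDiffAt_tangentBundle_prodMk
        (hX.comp p contMDiffAt_fst) (contMDiff_tangentBundle_zero contMDiff_snd p))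
  have hsnd {k : M × Q → ℝ} (hk : SmoothFun (I.prod J) k) (X : ∀ q : Q, TangentSpace J q)
      (hX : ContMDiffAt J J.tangent ∞ (T% X) p.2) :
      ContMDiffAt (I.prod J) 𝓘(ℝ, ℝ) ∞ (fun z => coSnd (dif (I.prod J) k z) (X z.2)) p :=
    ContMDiffAt.comp (g := fun v : TangentBundle (I.prod J) (M × Q) => dif (I.prod J) k v.1 v.2)
      p hk.smoothForm_dif.contMDiffAt (contMDiffAt_tangentBundle_prodMk
        (contMDiff_tangentBundle_zero contMDiff_fst p) (hX.comp p contMDiffAt_snd))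
  have hsplit : bivectorBracket (I.prod J) (sumBivector P S) f h = fun z =>
      (P z.1).eval (coFst (dif (I.prod J) f z)) (coFst (dif (I.prod J) h z)) +
        (S z.2).eval (coSnd (dif (I.prod J) f z)) (coSnd (dif (I.prod J) h z)) :=
    funext fun z => covector_apply_eq_add (dif (I.prod J) h z) _
  rw [hsplit]
  exact (hP.contMDiffAt_eval_comp contMDiffAt_fst (hfst hf) (hfst hh)).add
    (hS.contMDiffAt_eval_comp contMDiffAt_snd (hsnd hf) (hsnd hh))

theorem IsPoisson.sum (hP : IsPoisson I P) (hS : IsPoisson J S) :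
    IsPoisson (I.prod J) (sumBivector P S) := by
  refine ⟨hP.1.sum hS.1, fun f g h hf hg hh p => ?_⟩
  have hsum {k : M × Q → ℝ} (hk : SmoothFun (I.prod J) k) :
      SmoothFun (I.prod J) (sumFun (fun x => k (x, p.2)) fun q => k (p.1, q)) :=
    (hk.slice_fst p.2).sumFun (hk.slice_snd p.1)
  rw [← schoutenBracket_congr (hP.1.sum hS.1) (hsum hf) hf (hsum hg) hg (hsum hh) hh
      (dif_sumFun_slices hf p) (dif_sumFun_slices hg p) (dif_sumFun_slices hh p),
    schoutenBracket_sumBivector hP.1 hS.1 (hf.slice_fst _) (hf.slice_snd _) (hg.slice_fst _)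
      (hg.slice_snd _) (hh.slice_fst _) (hh.slice_snd _),
    hP.2 _ _ _ (hf.slice_fst _) (hg.slice_fst _) (hh.slice_fst _),
    hS.2 _ _ _ (hf.slice_snd _) (hg.slice_snd _) (hh.slice_snd _), add_zero]

theorem IsNijenhuis.sum (hN : IsNijenhuis I N) (hL : IsNijenhuis J L) :
    IsNijenhuis (I.prod J) (sumEndo N L) := by
  refine ⟨hN.1.sumEndo hL.1, fun X Y hX hY p => ?_⟩
  have hX₁ := hX.slice_fst p.2
  have hX₂ := hX.slice_snd p.1
  have hY₁ := hY.slice_fst p.2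
  have hY₂ := hY.slice_snd p.1
  rw [nijenhuisTorsion_congr (hN.1.sumEndo hL.1) hX (hX₁.sumVF hX₂) hY (hY₁.sumVF hY₂) rfl rfl,
    nijenhuisTorsion_sumEndo hN.1 hL.1 hX₁ hX₂ hY₁ hY₂]
  exact Prod.ext (hN.2 _ _ hX₁ hY₁ p.1) (hL.2 _ _ hX₂ hY₂ p.2)

theorem IsPoissonNijenhuis.sum (hPN : IsPoissonNijenhuis I P N) (hSL : IsPoissonNijenhuis J S L) :
    IsPoissonNijenhuis (I.prod J) (sumBivector P S) (sumEndo N L) := by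
  have hcomm (p : M × Q) (ξ : TangentSpace (I.prod J) p →L[ℝ] ℝ) :
      sumEndo N L p ((sumBivector P S p).sharp ξ) =
        (sumBivector P S p).sharp (ξ.comp (sumEndo N L p)) :=
    Prod.ext
      ((hPN.comm p.1 (coFst ξ)).trans (congrArg (P p.1).sharp (coFst_comp_sumEndo ξ).symm))
      ((hSL.comm p.2 (coSnd ξ)).trans (congrArg (S p.2).sharp (coSnd_comp_sumEndo ξ).symm))
  refine ⟨hPN.poisson.sum hSL.poisson, hPN.nijenhuis.sum hSL.nijenhuis, hcomm,
    fun α β hα hβ Y hY p => ?_⟩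
  have hα₁ := hα.slice_fst p.2
  have hα₂ := hα.slice_snd p.1
  have hβ₁ := hβ.slice_fst p.2
  have hβ₂ := hβ.slice_snd p.1
  have hY₁ := hY.slice_fst p.2
  have hY₂ := hY.slice_snd p.1
  rw [← concomitant_congr (hPN.poisson.1.sum hSL.poisson.1)
      (hPN.nijenhuis.1.sumEndo hSL.nijenhuis.1) hcomm (hα₁.sumForm hα₂) hα (hβ₁.sumForm hβ₂) hβ
      (hY₁.sumVF hY₂) hY (sumForm_slices α p) (sumForm_slices β p) rfl,
    concomitant_sumBivector hPN.poisson.1 hSL.poisson.1 hPN.nijenhuis.1 hSL.nijenhuis.1 hα₁ hα₂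
      hβ₁ hβ₂ hY₁ hY₂,
    hPN.concomitant_eq_zero _ _ hα₁ hβ₁ _ hY₁, hSL.concomitant_eq_zero _ _ hα₂ hβ₂ _ hY₂, add_zero]

end Structures

end DirectSum

section ZeroStructure

variable {E : Type*} [NormedAddCommGroup E] [NormedSpace ℝ E] {H : Type*} [TopologicalSpace H]
  {I : ModelWithCorners ℝ E H} {M : Type*} [TopologicalSpace M] [ChartedSpace H M]

theorem formBracket_zero (α β : ∀ x : M, TangentSpace I x →L[ℝ] ℝ) (Y : ∀ x : M, TangentSpace I x)
    (x : M) : formBracket I (fun _ _ => 0) α β Y x = 0 := by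
  have hlie (γ : ∀ x : M, TangentSpace I x →L[ℝ] ℝ) : lieDerivForm I (fun _ => 0) γ Y x = 0 := by
    have hY : mlieBracket I (0 : ∀ x : M, TangentSpace I x) Y x = 0 :=
      congrFun mlieBracket_zero_left x
    exact (congrArg₂ (· - ·) (map_zero _) ((congrArg (γ x) hY).trans (map_zero _))).trans
      (sub_zero 0)
  have hdif : dif I (fun y => β y 0) x = 0 :=
    (congrArg (dif I · x) (funext fun y => map_zero (β y))).trans dif_zero
  rw [formBracket, hlie, hlie, hdif, sub_zero, zero_apply, sub_zero]

theorem isPoisson_zero :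
    IsPoisson I (fun x : M => (Bivector.zero : Bivector (TangentSpace I x))) := by
  have hbracket (f g : M → ℝ) : bivectorBracket I
      (fun x : M => (Bivector.zero : Bivector (TangentSpace I x))) f g = fun _ => 0 :=
    funext fun x => map_zero (dif I g x)
  refine ⟨fun f g _ _ => ?_, fun f g h _ _ _ x => ?_⟩
  · rw [hbracket]
    exact contMDiff_const
  · simp only [schoutenBracket, hbracket, add_zero]

variable [IsManifold I ∞ M]

theorem isNijenhuis_zero : IsNijenhuis I (fun x : M => (0 : TangentSpace I x →L[ℝ] _)) := by
  refine ⟨contMDiff_tangentBundle_zero (Bundle.contMDiff_proj (TangentSpace I)),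
    fun X Y _ _ x => ?_⟩
  have hbracket : mlieBracket I (0 : ∀ x : M, TangentSpace I x) 0 x = 0 :=
    congrFun mlieBracket_zero_left x
  change mlieBracket I (0 : ∀ x : M, TangentSpace I x) 0 x - 0 - 0 + 0 = 0
  rw [hbracket, sub_zero, sub_zero, add_zero]

theorem isPoissonNijenhuis_zero :
    IsPoissonNijenhuis I (fun x : M => (Bivector.zero : Bivector (TangentSpace I x)))
      (fun _ => 0) where
  poisson := isPoisson_zero
  nijenhuis := isNijenhuis_zero
  comm _ _ := rfl
  concomitant_eq_zero α β _ _ Y _ x := by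
    change formBracket I (fun _ _ => 0) α β Y x -
      (formBracket I (fun _ _ => 0) (fun y => (α y).comp 0) β Y x
        + formBracket I (fun _ _ => 0) α (fun y => (β y).comp 0) Y x
        - formBracket I (fun _ _ => 0) α β (fun _ => 0) x) = 0
    simp only [formBracket_zero, add_zero, sub_zero]

end ZeroStructure

section TrivialGroupoid

theorem Bivector.ext_sharp {V : Type*} [AddCommGroup V] [Module ℝ V] [TopologicalSpace V]
    {P S : Bivector V} (h : ∀ ξ, P.sharp ξ = S.sharp ξ) : P = S := by
  obtain ⟨_, _⟩ := P
  obtain ⟨_, _⟩ := S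
  congr 1
  exact LinearMap.ext h

section Group

variable {F : Type*} [NormedAddCommGroup F] [NormedSpace ℝ F] {K : Type*} [TopologicalSpace K]
  {J : ModelWithCorners ℝ F K} {G : Type*} [TopologicalSpace G] [ChartedSpace K G] [Group G]

theorem groupRight_one : groupRight J (1 : G) = ContinuousLinearMap.id ℝ _ := by
  have hmul : (fun b : G => b * 1) = id := funext mul_one
  rw [groupRight, hmul]
  exact mfderiv_id

theorem groupRightInv_one : groupRightInv J (1 : G) = ContinuousLinearMap.id ℝ _ := by
  have hmul : (fun b : G => b * 1⁻¹) = id := funext fun b => by rw [inv_one, mul_one, id]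
  rw [groupRightInv, hmul]
  exact mfderiv_id

theorem groupBivector_one (Λ : Bivector (GroupLieAlgebra J G)) : groupBivector J Λ (1 : G) = Λ := by
  rw [groupBivector, groupRight_one]
  rfl

theorem groupEndo_one (n : GroupLieAlgebra J G →L[ℝ] GroupLieAlgebra J G) :
    groupEndo J n (1 : G) = n := by
  rw [groupEndo, groupRight_one, groupRightInv_one]
  rfl

end Group

variable {E : Type*} [NormedAddCommGroup E] [NormedSpace ℝ E] {H : Type*} [TopologicalSpace H]
  {I : ModelWithCorners ℝ E H} {M : Type*} [TopologicalSpace M] [ChartedSpace H M]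
  {F : Type*} [NormedAddCommGroup F] [NormedSpace ℝ F] {K : Type*} [TopologicalSpace K]
  {J : ModelWithCorners ℝ F K} {G : Type*} [TopologicalSpace G] [ChartedSpace K G]
  {PM : ∀ x : M, Bivector (TangentSpace I x)} {PG : ∀ a : G, Bivector (TangentSpace J a)}
  {NM : ∀ x : M, TangentSpace I x →L[ℝ] TangentSpace I x}
  {NG : ∀ a : G, TangentSpace J a →L[ℝ] TangentSpace J a}

theorem tripleBivector_eq_sumBivector : tripleBivector I J PM PG =
    sumBivector PM (sumBivector PG fun x : M => (Bivector.zero : Bivector (TangentSpace I x))) :=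
  rfl

theorem tripleEndo_eq_sumEndo :
    tripleEndo I J NM NG = sumEndo NM (sumEndo NG fun _ : M => 0) :=
  rfl

theorem IsPoissonNijenhuis.triple [FiniteDimensional ℝ E] [IsManifold I ∞ M] [T2Space M]
    [FiniteDimensional ℝ F] [IsManifold J ∞ G] [T2Space G] (hM : IsPoissonNijenhuis I PM NM)
    (hG : IsPoissonNijenhuis J PG NG) :
    IsPoissonNijenhuis (I.prod (J.prod I)) (tripleBivector I J PM PG) (tripleEndo I J NM NG) := by
  rw [tripleBivector_eq_sumBivector, tripleEndo_eq_sumEndo]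
  exact hM.sum (hG.sum isPoissonNijenhuis_zero)

variable [IsManifold I ∞ M] [Group G] [LieGroup J ∞ G]

/- Along a source fibre `{(x, b, y)}`, with `y` fixed, `R_g` is `(x, b) ↦ (x, b a, z)` for
`g = (y, a, z)`; restricting `R_g` to this fibre determines its derivative on `(X, V, 0)`. -/
theorem mfderivWithin_rightTrans_apply (g p : M × G × M) (hp : p.2.2 = g.1)
    (X : TangentSpace I p.1) (V : TangentSpace J p.2.1) :
    mfderivWithin (I.prod (J.prod I)) (I.prod (J.prod I))
        ((trivialGroupoid I M J G).rightTrans g) ((trivialGroupoid I M J G).rightDomain g) p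
        (tangentTriple I J p (X, V, 0)) =
      ((X, mfderiv J J (fun b : G => b * g.2.1) p.2.1 V, 0) : E × F × E) := by
  obtain ⟨x, b, y⟩ := p
  have hmul : ContMDiff J J ∞ (fun b : G => b * g.2.1) := contMDiff_id.mul contMDiff_const
  have hsmooth : ContMDiff (I.prod (J.prod I)) (I.prod (J.prod I)) ∞
      ((trivialGroupoid I M J G).rightTrans g) :=
    contMDiff_fst.prodMk ((hmul.comp (contMDiff_fst.comp contMDiff_snd)).prodMk contMDiff_const)
  have hright := (hsmooth.mdifferentiable (by simp) (x, b, y)).mdifferentiableWithinAt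
    (s := (trivialGroupoid I M J G).rightDomain g) |>.hasMFDerivWithinAt
  have hfibre : HasMFDerivAt (I.prod J) (I.prod (J.prod I)) (fun q : M × G => (q.1, q.2, y)) (x, b)
      ((ContinuousLinearMap.fst ℝ E F).prod ((ContinuousLinearMap.snd ℝ E F).prod 0)) :=
    (hasMFDerivAt_fst (x, b)).prodMk
      ((hasMFDerivAt_snd (x, b)).prodMk (hasMFDerivAt_const y (x, b)))
  have hcomp : HasMFDerivAt (I.prod J) (I.prod (J.prod I))
      (fun q : M × G => (q.1, q.2 * g.2.1, g.2.2)) (x, b) _ :=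
    (hasMFDerivAt_fst (x, b)).prodMk
      (((hmul.mdifferentiable (by simp) b).hasMFDerivAt.comp (x, b)
        (hasMFDerivAt_snd (x, b))).prodMk (hasMFDerivAt_const g.2.2 (x, b)))
  have hrestrict := hright.comp (x, b) hfibre.hasMFDerivWithinAt (s := Set.univ)
    (show Set.univ ⊆ _ ⁻¹' (trivialGroupoid I M J G).rightDomain g from fun _ _ => hp)
  rw [hasMFDerivWithinAt_univ] at hrestrict
  exact congrArg (fun L : E × F →L[ℝ] E × F × E => L (X, V)) (hasMFDerivAt_unique hrestrict hcomp)

theorem dRight_trivialGroupoid (g : M × G × M) (X : TangentSpace I g.1) (V : GroupLieAlgebra J G) :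
    (trivialGroupoid I M J G).dRight g (tangentTriple I J (g.1, 1, g.1) (X, V, 0)) =
      tangentTriple I J g (X, groupRight J g.2.1 V, 0) :=
  mfderivWithin_rightTrans_apply g (g.1, 1, g.1) rfl X V

theorem dRightInv_trivialGroupoid (g : M × G × M) (X : TangentSpace I g.1)
    (V : TangentSpace J g.2.1) :
    (trivialGroupoid I M J G).dRightInv g (tangentTriple I J g (X, V, 0)) =
      tangentTriple I J (g.1, 1, g.1) (X, groupRightInv J g.2.1 V, 0) :=
  mfderivWithin_rightTrans_apply ((trivialGroupoid I M J G).inv g) g rfl X V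

theorem tripleBivector_eq_rightBivector (Λ : Bivector (GroupLieAlgebra J G)) :
    tripleBivector I J PM (groupBivector J Λ) =
      (trivialGroupoid I M J G).rightBivector (trivialBivector I J PM Λ) := by
  funext g
  refine Bivector.ext_sharp fun ξ => ?_
  let D : (TangentSpace I g.1 × GroupLieAlgebra J G) →L[ℝ] TangentSpace (I.prod (J.prod I)) g :=
    (((trivialGroupoid I M J G).dRight g).comp
      ((trivialGroupoid I M J G).algebroid g.1).subtypeL).comp
        (trivialAlgebroid I J g.1).toContinuousLinearMap
  have hD (X : TangentSpace I g.1) (V : GroupLieAlgebra J G) :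
      D (X, V) = tangentTriple I J g (X, groupRight J g.2.1 V, 0) := dRight_trivialGroupoid g X V
  have hfst : (ξ.comp D).comp (ContinuousLinearMap.inl ℝ _ _) = coFst ξ :=
    ContinuousLinearMap.ext fun X => (congrArg ξ (hD X 0)).trans
      (congrArg (fun z : F => ξ ((X, z, 0) : E × F × E)) (map_zero (groupRight J g.2.1)))
  have hsnd : (ξ.comp D).comp (ContinuousLinearMap.inr ℝ _ _) =
      (coFst (coSnd ξ)).comp (groupRight J g.2.1) :=
    ContinuousLinearMap.ext fun V => congrArg ξ (hD 0 V)
  change _ = D ((PM g.1).sharp ((ξ.comp D).comp (ContinuousLinearMap.inl ℝ _ _)),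
    Λ.sharp ((ξ.comp D).comp (ContinuousLinearMap.inr ℝ _ _)))
  rw [hfst, hsnd]
  exact (hD _ _).symm

theorem smoothBivectorSection_trivialBivector {Λ : Bivector (GroupLieAlgebra J G)}
    (h : SmoothBivector (I.prod (J.prod I)) (tripleBivector I J PM (groupBivector J Λ))) :
    (trivialGroupoid I M J G).SmoothBivectorSection (trivialBivector I J PM Λ) := by
  intro u v hu hv
  refine (ContMDiff.comp (h u v hu hv) (trivialGroupoid I M J G).smooth_unit).congr fun x => ?_
  change _ = dif (I.prod (J.prod I)) v (x, 1, x) (tangentTriple I J (x, 1, x)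
    ((PM x).sharp (coFst (dif (I.prod (J.prod I)) u (x, 1, x))),
      (groupBivector J Λ (1 : G)).sharp (coFst (coSnd (dif (I.prod (J.prod I)) u (x, 1, x)))), 0))
  rw [groupBivector_one]
  rfl

theorem coe_trivialEndo_apply (n : GroupLieAlgebra J G →L[ℝ] GroupLieAlgebra J G) (x : M)
    (a : (trivialGroupoid I M J G).algebroid x) :
    (trivialEndo I J NM n x a).1 = tripleEndo I J NM (groupEndo J n) (x, (1 : G), x) a.1 := by
  change _ = tangentTriple I J (x, (1 : G), x)
    (NM x ((tangentTriple I J (x, (1 : G), x)).symm a.1).1,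
      groupEndo J n (1 : G) ((tangentTriple I J (x, (1 : G), x)).symm a.1).2.1, 0)
  rw [groupEndo_one]
  rfl

theorem smoothEndoSection_trivialEndo {n : GroupLieAlgebra J G →L[ℝ] GroupLieAlgebra J G}
    (h : SmoothEndo (I.prod (J.prod I)) (tripleEndo I J NM (groupEndo J n))) :
    (trivialGroupoid I M J G).SmoothEndoSection (trivialEndo I J NM n) := by
  intro a ha
  unfold LieGroupoid.SmoothSection
  simp only [coe_trivialEndo_apply]
  exact ContMDiff.comp h ha

theorem isRightEndo_trivialEndo (n : GroupLieAlgebra J G →L[ℝ] GroupLieAlgebra J G) :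
    (trivialGroupoid I M J G).IsRightEndo (trivialEndo I J NM n)
      (tripleEndo I J NM (groupEndo J n)) := by
  intro g v hv
  obtain ⟨⟨X, V, W⟩, rfl⟩ := (tangentTriple I J g).surjective v
  obtain rfl : W = 0 := (mem_vertical_trivialGroupoid I J g (X, V, W)).1 hv
  exact ⟨trivialAlgebroid I J g.1 (X, groupRightInv J g.2.1 V),
    (dRightInv_trivialGroupoid g X V).symm,
    (dRight_trivialGroupoid g (NM g.1 X) (n (groupRightInv J g.2.1 V))).symm⟩

theorem mfderiv_tgt_tripleEndo (g : M × G × M) (v : TangentSpace (I.prod (J.prod I)) g) :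
    mfderiv (I.prod (J.prod I)) I (trivialGroupoid I M J G).tgt g (tripleEndo I J NM NG g v) =
      NM ((trivialGroupoid I M J G).tgt g)
        (mfderiv (I.prod (J.prod I)) I (trivialGroupoid I M J G).tgt g v) := by
  have htgt : mfderiv (I.prod (J.prod I)) I (trivialGroupoid I M J G).tgt g =
      ContinuousLinearMap.fst ℝ (TangentSpace I g.1) (TangentSpace (J.prod I) g.2) := mfderiv_fst
  rw [htgt]
  rfl

end TrivialGroupoid

end

theorem proposition4p2_general
    {E : Type*} [NormedAddCommGroup E] [NormedSpace ℝ E] [FiniteDimensional ℝ E]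
    {H : Type*} [TopologicalSpace H] (I : ModelWithCorners ℝ E H)
    {M : Type*} [TopologicalSpace M] [ChartedSpace H M] [IsManifold I ∞ M] [T2Space M]
    {F : Type*} [NormedAddCommGroup F] [NormedSpace ℝ F] [FiniteDimensional ℝ F]
    {K : Type*} [TopologicalSpace K] (J : ModelWithCorners ℝ F K)
    {G : Type*} [TopologicalSpace G] [ChartedSpace K G] [Group G] [LieGroup J ∞ G] [T2Space G]
    (PM : ∀ x : M, Bivector (TangentSpace I x))
    (NM : ∀ x : M, TangentSpace I x →L[ℝ] TangentSpace I x)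
    (hM : IsPoissonNijenhuis I PM NM)
    (PG : ∀ a : G, Bivector (TangentSpace J a))
    (NG : ∀ a : G, TangentSpace J a →L[ℝ] TangentSpace J a)
    (hG : IsRightInvariantPNGroup J PG NG) :
    (trivialGroupoid I M J G).IsRightInvariantPN
        (tripleBivector I J PM PG) (tripleEndo I J NM NG) NM ∧
      (∀ ΛG : Bivector (GroupLieAlgebra J G), PG = groupBivector J ΛG →
        (trivialGroupoid I M J G).SmoothBivectorSection (trivialBivector I J PM ΛG) ∧
        tripleBivector I J PM PG =
          (trivialGroupoid I M J G).rightBivector (trivialBivector I J PM ΛG)) ∧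
      (∀ nG : GroupLieAlgebra J G →L[ℝ] GroupLieAlgebra J G, NG = groupEndo J nG →
        (trivialGroupoid I M J G).SmoothEndoSection (trivialEndo I J NM nG) ∧
        (trivialGroupoid I M J G).IsRightEndo (trivialEndo I J NM nG)
          (tripleEndo I J NM NG)) := by
  have hpn := hM.triple hG.pn
  have hbiv (ΛG : Bivector (GroupLieAlgebra J G)) (hΛ : PG = groupBivector J ΛG) :
      (trivialGroupoid I M J G).SmoothBivectorSection (trivialBivector I J PM ΛG) ∧
        tripleBivector I J PM PG =
          (trivialGroupoid I M J G).rightBivector (trivialBivector I J PM ΛG) := by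
    subst hΛ
    exact ⟨smoothBivectorSection_trivialBivector hpn.poisson.1, tripleBivector_eq_rightBivector ΛG⟩
  have hend (nG : GroupLieAlgebra J G →L[ℝ] GroupLieAlgebra J G) (hn : NG = groupEndo J nG) :
      (trivialGroupoid I M J G).SmoothEndoSection (trivialEndo I J NM nG) ∧
        (trivialGroupoid I M J G).IsRightEndo (trivialEndo I J NM nG) (tripleEndo I J NM NG) := by
    subst hn
    exact ⟨smoothEndoSection_trivialEndo hpn.nijenhuis.1, isRightEndo_trivialEndo nG⟩
  obtain ⟨ΛG, hΛ⟩ := hG.bivector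
  obtain ⟨nG, hn⟩ := hG.endo
  exact ⟨⟨hpn, ⟨_, hbiv ΛG hΛ⟩, ⟨_, hend nG hn⟩, hM.nijenhuis, mfderiv_tgt_tripleEndo⟩, hbiv, hend⟩

theorem proposition4p2
    {E : Type*} [NormedAddCommGroup E] [NormedSpace ℝ E] [FiniteDimensional ℝ E]
    {H : Type*} [TopologicalSpace H] (I : ModelWithCorners ℝ E H) [I.Boundaryless]
    {M : Type*} [TopologicalSpace M] [ChartedSpace H M] [IsManifold I ∞ M] [T2Space M]
    {F : Type*} [NormedAddCommGroup F] [NormedSpace ℝ F] [FiniteDimensional ℝ F]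
    {K : Type*} [TopologicalSpace K] (J : ModelWithCorners ℝ F K) [J.Boundaryless]
    {G : Type*} [TopologicalSpace G] [ChartedSpace K G] [Group G] [LieGroup J ∞ G] [T2Space G]
    (PM : ∀ x : M, Bivector (TangentSpace I x))
    (NM : ∀ x : M, TangentSpace I x →L[ℝ] TangentSpace I x)
    (hM : IsPoissonNijenhuis I PM NM)
    (PG : ∀ a : G, Bivector (TangentSpace J a))
    (NG : ∀ a : G, TangentSpace J a →L[ℝ] TangentSpace J a)
    (hG : IsRightInvariantPNGroup J PG NG) :
    (trivialGroupoid I M J G).IsRightInvariantPN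
        (tripleBivector I J PM PG) (tripleEndo I J NM NG) NM ∧
      (∀ ΛG : Bivector (GroupLieAlgebra J G), PG = groupBivector J ΛG →
        (trivialGroupoid I M J G).SmoothBivectorSection (trivialBivector I J PM ΛG) ∧
        tripleBivector I J PM PG =
          (trivialGroupoid I M J G).rightBivector (trivialBivector I J PM ΛG)) ∧
      (∀ nG : GroupLieAlgebra J G →L[ℝ] GroupLieAlgebra J G, NG = groupEndo J nG →
        (trivialGroupoid I M J G).SmoothEndoSection (trivialEndo I J NM nG) ∧
        (trivialGroupoid I M J G).IsRightEndo (trivialEndo I J NM nG)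
          (tripleEndo I J NM NG)) :=
  proposition4p2_general I J PM NM hM PG NG hG
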